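/- Let $q\in\{2,3\}$, $d_2=6$, $d_3=2$. For nonzero $F,G\in\mathbb F_q[T]$ put $\varphi(F)=\#(\mathbb F_q[T]/(F))^*$ and $\sigma(G)=\sum_{D\mid G,\ D\text{ monic}}q^{\deg D}$. For a tuple $\mathbf v=(v_0,v_1,\dots,v_m)$ of positive integers with $m\ge 1$, let $V_q(\mathbf v)$ be the set of pairs $(F,G)$ such that there are monic irreducible polynomials $P_1,\dots,P_{m+1}$ with $\deg P_k=v_0\prod_{i=1}^{k-1}(v_i+1)$, $F=P_{m+1}$ and $G=\prod_{i=1}^m P_i^{v_i}$. Call $\mathbf v$ reduced if $v_0(v_1+1)\nmid d_q$ (when $v_0\mid d_q$, this says that $P_1$ is the only one of the $P_k$ whose degree divides $d_q$). Let $E_q$ be the set of pairs $(F_0,G_0)$ of nonzero polynomials such that $F_0$ is squarefree, every prime factor of $F_0$ has degree dividing $d_q$, and $(e+1)\deg P\mid d_q$ whenever $P$ is irreducible, $e\ge1$ and $P^e$ exactly divides $G_0$. A decomposition of $(F,G)$ of type $(\mathbf v_1,\dots,\mathbf v_n)$, $n\ge0$, with $\mathbf v_i=(v_{i,0},v_{i,1},\dots)$,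 is a pair of factorizations $F=\prod_{i=0}^nF_i$, $G=\prod_{i=0}^nG_i$ with $\gcd(F_i,F_j)=\gcd(G_i,G_j)=1$ for $i\ne j$, and, for $1\le i\le n$, $(F_i,G_i)\in V_q(\mathbf v_i)$ and $v_{i,0}\mid d_q$. Say that $(\mathbf v_1,\dots,\mathbf v_n)$ occurs if some monic $F,G$ with $\varphi(F)=\sigma(G)$ have a decomposition of this type with $(F_0,G_0)\in E_q$. The set $E_q$ is finite, and all nonzero $F,G$ with $\varphi(F)=\sigma(G)$ have a decomposition with $(F_0,G_0)\in E_q$ and all $\mathbf v_i$ reduced. Moreover: 1. Let $q=3$. If $\varphi(F)=\sigma(G)$ with $F,G\neq 0$, then every decomposition of $(F,G)$ (whether or not $(F_0,G_0)\in E_3$) has $n\le2$. Conversely, for each $n\le 2$, all tuples $\mathbf v_1,\dots,\mathbf v_n$ with $v_{i,0}\mid2$ for all $i$ occur. 2. Let $q=2$. If $\varphi(F)=\sigma(G)$ with $F,G\neq 0$, then every decomposition of $(F,G)$ (whether or not $(F_0,G_0)\in E_2$) has $n\le3$; moreover there are no indices $i\ne j$ with $v_{i,0}=v_{j,0}=2$,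 and if $n=3$ then $(v_{1,0},v_{2,0},v_{3,0})\neq(1,1,1)$. Conversely: the empty family ($n=0$) occurs, and for $n=1$ every $\mathbf v_1$ with $v_{1,0}\mid 6$ occurs; for $n=2$ all reduced $\mathbf v_1,\mathbf v_2$ with $v_{1,0},v_{2,0}\mid 6$ occur except when $(v_{1,0},v_{2,0})=(2,2)$; for $n=3$ all reduced $\mathbf v_1,\mathbf v_2,\mathbf v_3$ with $v_{1,0},v_{2,0}\mid6$ and $v_{3,0}=1$ occur except when $(v_{1,0},v_{2,0})=(2,2)$ or $(v_{1,0},v_{2,0},v_{3,0})=(1,1,1)$. -/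

import Mathlib

open scoped Polynomial

namespace PhiSigma

/-- The norm `|A| = q ^ deg A` of a polynomial over the field with `q` elements. -/
noncomputable def norm (K : Type*) [Field K] (A : K[X]) : ℕ :=
  Nat.card K ^ A.natDegree

/-- Euler's function `φ(F) = #(K[T]/(F))ˣ`. -/
noncomputable def phi (K : Type*) [Field K] (F : K[X]) : ℕ :=
  Nat.card (K[X] ⧸ Ideal.span {F})ˣ

/-- The sum of divisors function `σ(G) = ∑ |D|` over the monic divisors `D` of `G`
(a finite sum when `K` is finite and `G ≠ 0`). -/
noncomputable def sigma (K : Type*) [Field K] (G : K[X]) : ℕ :=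
  ∑ᶠ D ∈ {D : K[X] | D.Monic ∧ D ∣ G}, norm K D

/-- A tuple `(v_0, v_1, …, v_m)` of positive integers with `m ≥ 1`; here `m` is `len`,
and the values of `val` beyond the index `len` play no role. -/
structure ExpTuple where
  len : ℕ
  val : ℕ → ℕ
  one_le_len : 1 ≤ len
  val_pos : ∀ i ≤ len, 0 < val i

/-- The degree `v_0 * ∏_{i=1}^{k-1} (v_i + 1)` prescribed for the `k`-th prime of a chain. -/
def ExpTuple.deg (v : ExpTuple) (k : ℕ) : ℕ :=
  v.val 0 * ∏ i ∈ Finset.Ico 1 k, (v.val i + 1)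

/-- `v` is reduced for `d` if `v_0 (v_1 + 1) ∤ d`; when `v_0 ∣ d`, this means that the first prime
of a chain is the only one whose degree divides `d`. -/
def ExpTuple.Reduced (d : ℕ) (v : ExpTuple) : Prop :=
  ¬ v.val 0 * (v.val 1 + 1) ∣ d

/-- The set `V_q(v)` of pairs `(F, G)` with `G = ∏_{k=1}^m P_k ^ v_k`, `F = P_{m+1}`, for (monic)
primes `P_1, …, P_{m+1}` of degree `deg P_k = v_0 * ∏_{i=1}^{k-1} (v_i + 1)`. -/
def chainSet (K : Type*) [Field K] (v : ExpTuple) : Set (K[X] × K[X]) :=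
  {p | ∃ P : ℕ → K[X],
    (∀ k ∈ Finset.Icc 1 (v.len + 1),
      (P k).Monic ∧ Irreducible (P k) ∧ (P k).natDegree = v.deg k) ∧
    p.1 = P (v.len + 1) ∧
    p.2 = ∏ k ∈ Finset.Icc 1 v.len, P k ^ v.val k}

/-- The exceptional pairs `(F_0, G_0)`: `F_0` is squarefree with all prime factors of degree
dividing `d`, and `(e + 1) deg P ∣ d` whenever `P ^ e` exactly divides `G_0`, `e ≥ 1`. -/
def exceptionalSet (K : Type*) [Field K] (d : ℕ) : Set (K[X] × K[X]) :=
  {p | Squarefree p.1 ∧ (∀ P : K[X], Irreducible P → P ∣ p.1 → P.natDegree ∣ d) ∧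
    p.2 ≠ 0 ∧ (∀ (P : K[X]) (e : ℕ), Irreducible P → 0 < e → P ^ e ∣ p.2 → ¬ P ^ (e + 1) ∣ p.2 →
      (e + 1) * P.natDegree ∣ d)}

/-- `F = F_0 F_1 ⋯ F_n` and `G = G_0 G_1 ⋯ G_n` with the `F_i` pairwise coprime, the `G_i` pairwise
coprime, and `(F_i, G_i) ∈ V_q(v_i)`, `v_{i,0} ∣ d` for `1 ≤ i ≤ n`. -/
structure IsDecomposition {K : Type*} [Field K] (d : ℕ) (F G : K[X]) {n : ℕ}
    (v : Fin n → ExpTuple) (A B : Fin (n + 1) → K[X]) : Prop where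
  prod_left : F = ∏ i, A i
  prod_right : G = ∏ i, B i
  coprime_left : ∀ i j, i ≠ j → IsCoprime (A i) (A j)
  coprime_right : ∀ i j, i ≠ j → IsCoprime (B i) (B j)
  mem_chainSet : ∀ i : Fin n, (A i.succ, B i.succ) ∈ chainSet K (v i)
  dvd : ∀ i : Fin n, (v i).val 0 ∣ d

/-- The family `v_1, …, v_n` occurs: some solution of `φ(F) = σ(G)` in monic polynomials
has a decomposition with exactly these tuples and with an exceptional pair `(F_0, G_0)`. -/
def Occurs (K : Type*) [Field K] (d : ℕ) {n : ℕ} (v : Fin n → ExpTuple) : Prop :=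
  ∃ (F G : K[X]) (A B : Fin (n + 1) → K[X]), F.Monic ∧ G.Monic ∧ phi K F = sigma K G ∧
    IsDecomposition d F G v A B ∧ (A 0, B 0) ∈ exceptionalSet K d

/-- The exceptional set is finite, and every solution of `φ(F) = σ(G)` in nonzero polynomials has a
decomposition (with reduced tuples) whose pair `(F_0, G_0)` is exceptional. -/
def HasDecompositions (K : Type*) [Field K] (d : ℕ) : Prop :=
  (exceptionalSet K d).Finite ∧
  ∀ F G : K[X], F ≠ 0 → G ≠ 0 → phi K F = sigma K G →
    ∃ (n : ℕ) (v : Fin n → ExpTuple) (A B : Fin (n + 1) → K[X]),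
      IsDecomposition d F G v A B ∧ (A 0, B 0) ∈ exceptionalSet K d ∧ ∀ i, (v i).Reduced d

end PhiSigma

/-! Both sides are governed by numbers q^n - 1. If P^2 divides F, then the characteristic p divides
φ(F) (`ringChar_dvd_phi_of_sq_dvd`), whereas σ(G) ≡ 1 mod p; so F is squarefree and φ(F) is the
product of q^deg P - 1 over its primes. As σ(P^e) = (q^((e+1) deg P) - 1)/(q^deg P - 1), clearing
denominators (`prod_pow_sub_one_eq`) puts the degrees of the primes of F and of G on one side and
the targets (e+1) deg P of the primes of G on the other.

By Zsigmondy's theorem q^n - 1 has a primitive prime whenever n does not divide d_q. Hence each such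
n occurs equally often on both sides (`count_eq_of_prod_eq`), and a bijection assigns to every prime
of G whose target does not divide d_q a successor, a prime of F or G of that degree. Following
successors produces the chains (`exists_chains`); the remaining primes form the exceptional pair
(`hasDecompositions`).

Along a chain φ(F_i)/σ(G_i) telescopes to q^v_{i,0} - 1, so for a decomposition the equation becomes
φ(F_0) ∏ (q^v_{i,0} - 1) = σ(G_0) (`IsDecomposition.phi_eq_sigma_iff`). The bounds on n compare
valuations in this identity, 2-adic for q = 3 and 7-adic for q = 2, with the scarcity of primes of
degree 1 and 2: the first primes of the chains and the primes of G_0 are all distinct. Conversely it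
suffices to solve this identity with a small pair (F_0, G_0) and to pick primes without collisions
(`occurs_of_table`), which a crude count of primes of each degree permits. -/

namespace PhiSigma

/-! ### Primitive prime divisors (Zsigmondy's theorem for q = 2 and q = 3) -/

section PrimitivePrimes

open Polynomial

/-- A prime divisor of `Φ_n(q)` determines `n` up to a power of that prime. -/
theorem exists_order_of_dvd_cyclotomic {q n r : ℕ} (hn : 0 < n) [Fact r.Prime]
    (h : (r : ℤ) ∣ (cyclotomic n ℤ).eval (q : ℤ)) :
    ∃ k m, n = r ^ k * m ∧ ¬ r ∣ m ∧ IsPrimitiveRoot (q : ZMod r) m := by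
  obtain ⟨k, m, hm, rfl⟩ := Nat.exists_eq_pow_mul_and_not_dvd hn.ne' r (Fact.out : r.Prime).ne_one
  refine ⟨k, m, rfl, hm, ?_⟩
  have : NeZero (m : ZMod r) := ⟨by rwa [Ne, ZMod.natCast_eq_zero_iff]⟩
  rw [← isRoot_cyclotomic_prime_pow_mul_iff_of_charP (p := r) (k := k)]
  have h1 : ((eval (q : ℤ) (cyclotomic (r ^ k * m) ℤ) : ℤ) : ZMod r) = 0 :=
    (ZMod.intCast_zmod_eq_zero_iff_dvd _ r).2 h
  rw [IsRoot.def]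
  have := cyclotomic.eval_apply (q : ℤ) (r ^ k * m) (Int.castRingHom (ZMod r))
  simpa [h1] using this

theorem natCast_pow_eq_one_iff {q r j : ℕ} (hq : 0 < q) :
    (q : ZMod r) ^ j = 1 ↔ r ∣ q ^ j - 1 := by
  rw [← ZMod.natCast_eq_zero_iff, Nat.cast_sub (Nat.one_le_pow _ _ hq)]
  simp [sub_eq_zero]

theorem cyclotomic_eval_mul_dvd {q n r : ℕ} (hn : 0 < n) (hr : r.Prime) (hrn : r ∣ n) :
    (cyclotomic n ℤ).eval (q : ℤ) * ((q : ℤ) ^ (n / r) - 1) ∣ (q : ℤ) ^ n - 1 := by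
  have h := X_pow_sub_one_mul_cyclotomic_dvd_X_pow_sub_one_of_dvd ℤ
    (d := n / r) (n := n) (Nat.mem_properDivisors.2 ⟨Nat.div_dvd_of_dvd hrn,
      Nat.div_lt_self hn hr.one_lt⟩)
  have := (evalRingHom (q : ℤ)).map_dvd h
  simpa [mul_comm] using this

/-- Lifting the exponent: passing from q^(n/r) - 1 to q^n - 1 raises the r-adic valuation by exactly
one, which leaves room for a single factor r in Φ_n(q). -/
theorem sq_not_dvd_cyclotomic_eval {q n r : ℕ} (hq : 1 < q) (hn : 0 < n) [hr : Fact r.Prime]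
    (hodd : Odd r) (hrn : r ∣ n) (h : r ∣ q ^ (n / r) - 1) :
    ¬ (r : ℤ) ^ 2 ∣ (cyclotomic n ℤ).eval (q : ℤ) := by
  intro hd
  have hnr : 0 < n / r := Nat.div_pos (Nat.le_of_dvd hn hrn) hr.out.pos
  set x := q ^ (n / r) with hx
  have hx1 : 1 < x := Nat.one_lt_pow hnr.ne' hq
  have hxn : q ^ n = x ^ r := by rw [hx, ← pow_mul, Nat.div_mul_cancel hrn]
  have h1 := (mul_dvd_mul_right hd _).trans (cyclotomic_eval_mul_dvd (q := q) hn hr.out hrn)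
  have h2 : r ^ 2 * (x - 1) ∣ x ^ r - 1 := by
    rw [← hxn]
    zify [hx1.le, Nat.one_le_pow n q (by omega)]
    simpa [hx] using h1
  have hrx : ¬ r ∣ x := fun hrx => by
    have := (Nat.dvd_sub_iff_right hx1.le hrx).1 h
    exact hr.out.one_lt.ne' (Nat.dvd_one.1 this)
  have h3 := padicValNat.pow_sub_pow hodd hx1 h hrx hr.out.ne_zero
  have h4 : x ^ r - 1 ≠ 0 := Nat.sub_ne_zero_of_lt (Nat.one_lt_pow hr.out.ne_zero hx1)
  have h5 : padicValNat r (r ^ 2 * (x - 1)) ≤ padicValNat r (x ^ r - 1) :=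
    (padicValNat_dvd_iff_le h4).1 ((pow_padicValNat_dvd).trans h2)
  rw [padicValNat.mul (pow_ne_zero _ hr.out.ne_zero) (Nat.sub_ne_zero_of_lt hx1),
    padicValNat.prime_pow] at h5
  simp only [one_pow, padicValNat_self] at h3
  omega

/-- A primitive prime of `q ^ n - 1`. -/
def IsPrimitivePrime (q n r : ℕ) : Prop :=
  r.Prime ∧ r ∣ q ^ n - 1 ∧ ∀ m, r ∣ q ^ m - 1 → n ∣ m

theorem IsPrimitiveRoot.isPrimitivePrime {q n r : ℕ} (hq : 0 < q) [hr : Fact r.Prime]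
    (h : IsPrimitiveRoot (q : ZMod r) n) : IsPrimitivePrime q n r :=
  ⟨hr.out, (natCast_pow_eq_one_iff hq).1 h.pow_eq_one,
    fun m hm => h.dvd_of_pow_eq_one m ((natCast_pow_eq_one_iff hq).2 hm)⟩

/-- If `q ^ n - 1` has no primitive prime, then `Φ_n(q)` is a single prime,
apart from a possible power of two. -/
theorem cyclotomic_eval_eq_prime {q n : ℕ} (hq : 1 < q) (hn : 1 < n)
    (h : ¬ ∃ r, IsPrimitivePrime q n r)
    (h2 : 2 ∣ n → ¬ (4 : ℤ) ∣ (cyclotomic n ℤ).eval (q : ℤ)) :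
    ∃ r k m, r.Prime ∧ 0 < k ∧ n = r ^ k * m ∧ ¬ r ∣ m ∧ IsPrimitiveRoot (q : ZMod r) m ∧
      (cyclotomic n ℤ).eval (q : ℤ) = r := by
  have hpos : 0 < (cyclotomic n ℤ).eval (q : ℤ) :=
    cyclotomic_pos' n (by exact_mod_cast hq)
  obtain ⟨N, hN⟩ := Int.eq_ofNat_of_zero_le hpos.le
  have hN1 : 1 < N := by
    have := sub_one_lt_natAbs_cyclotomic_eval hn hq.ne'
    rw [hN] at this
    simp at this; omega
  -- Here m is the order of q modulo r. It divides r - 1, so m < r; and k = 0 would make the order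
  -- equal to n, that is, r primitive.
  have key : ∀ r, r.Prime → r ∣ N → ∃ k m, 0 < k ∧ n = r ^ k * m ∧ ¬ r ∣ m ∧
      IsPrimitiveRoot (q : ZMod r) m ∧ m < r := by
    intro r hr hrN
    have := Fact.mk hr
    obtain ⟨k, m, hnk, hrm, hprim⟩ := exists_order_of_dvd_cyclotomic (q := q) (n := n) (r := r)
      (by omega) (by rw [hN]; exact_mod_cast hrN)
    have hm0 : m ≠ 0 := by rintro rfl; simp at hrm
    refine ⟨k, m, ?_, hnk, hrm, hprim, ?_⟩
    · refine Nat.pos_of_ne_zero fun hk => h ⟨r, ?_⟩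
      subst hk
      rw [pow_zero, one_mul] at hnk
      subst hnk
      exact IsPrimitiveRoot.isPrimitivePrime (by omega) hprim
    · have hq0 : (q : ZMod r) ≠ 0 := fun h0 => by
        have := hprim.pow_eq_one
        rw [h0, zero_pow hm0] at this
        exact zero_ne_one this
      have := Nat.le_of_dvd (Nat.sub_pos_of_lt hr.one_lt)
        (hprim.dvd_of_pow_eq_one _ (ZMod.pow_card_sub_one_eq_one hq0))
      have := hr.one_lt
      omega
  -- By `key` every prime factor of Φ_n(q) is the largest prime factor of n, so there is only one.
  have uniq : ∀ r s, r.Prime → s.Prime → r ∣ N → s ∣ N → r ≤ s := by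
    intro r s hr hs hrN hsN
    obtain ⟨k, m, hk, hnk, -, -, -⟩ := key r hr hrN
    obtain ⟨l, t, hl, hnl, hst, -, htlt⟩ := key s hs hsN
    have hrn : r ∣ s ^ l * t := hnl ▸ hnk ▸ (dvd_pow_self r hk.ne').mul_right m
    rcases (Nat.Prime.dvd_mul hr).1 hrn with h' | h'
    · exact Nat.le_of_dvd hs.pos (hr.dvd_of_dvd_pow h')
    · have : t ≠ 0 := by rintro rfl; simp at hst
      exact (Nat.le_of_dvd (by omega) h').trans htlt.le
  obtain ⟨r, hr, hrN⟩ := Nat.exists_prime_and_dvd hN1.ne'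
  obtain ⟨k, m, hk, hnk, hrm, hprim, -⟩ := key r hr hrN
  refine ⟨r, k, m, hr, hk, hnk, hrm, hprim, ?_⟩
  obtain ⟨t, ht⟩ := hrN
  have ht1 : t = 1 := by
    by_contra ht1
    obtain ⟨s, hs, hst⟩ := Nat.exists_prime_and_dvd ht1
    have hsr : s = r := le_antisymm (uniq s r hs hr (ht ▸ hst.mul_left r) ⟨t, ht⟩)
      (uniq r s hr hs ⟨t, ht⟩ (ht ▸ hst.mul_left r))
    subst hsr
    have hd : (s : ℤ) ^ 2 ∣ (cyclotomic n ℤ).eval (q : ℤ) := by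
      rw [hN, ht, pow_two]
      exact_mod_cast mul_dvd_mul_left s hst
    have hsn : s ∣ n := hnk ▸ (dvd_pow_self s hk.ne').mul_right m
    rcases hs.eq_two_or_odd' with rfl | hodd
    · exact h2 hsn (by simpa using hd)
    · have := Fact.mk hs
      refine sq_not_dvd_cyclotomic_eval hq (by omega) hodd hsn ?_ hd
      rw [← natCast_pow_eq_one_iff (by omega)]
      obtain ⟨j, rfl⟩ : ∃ j, k = j + 1 := ⟨k - 1, by omega⟩
      rw [hnk, pow_succ, mul_right_comm, Nat.mul_div_cancel _ hs.pos, mul_comm, pow_mul,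
        hprim.pow_eq_one, one_pow]
  rw [hN, ht, ht1, mul_one]

theorem cyclotomic_eval_cast (q n : ℕ) :
    (cyclotomic n ℝ).eval (q : ℝ) = ((cyclotomic n ℤ).eval (q : ℤ) : ℤ) := by
  simpa using cyclotomic.eval_apply (q : ℤ) n (algebraMap ℤ ℝ)

/-- Otherwise Φ_n(3) is a prime r dividing n. Then r - 1 ≤ φ(n), while Φ_n(3) > 2^φ(n) ≥ 2^(r-1) ≥
r. -/
theorem exists_isPrimitivePrime_three {n : ℕ} (hn : ¬ n ∣ 2) (hn0 : 0 < n) :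
    ∃ r, IsPrimitivePrime 3 n r := by
  by_contra h
  have hn2 : 2 < n := by
    by_contra hlt
    interval_cases n <;> simp at hn
  -- If Φ_n(3) is even, n is a power of 2 and at least 4. So Φ_n(3) divides 3^(n/2) + 1, which is 2
  -- mod 4 because n/2 is even.
  have h2 : 2 ∣ n → ¬ (4 : ℤ) ∣ (cyclotomic n ℤ).eval ((3 : ℕ) : ℤ) := by
    intro h2n hd
    obtain ⟨k, m, hnk, -, hprim⟩ := exists_order_of_dvd_cyclotomic (q := 3) (n := n) (r := 2)
      hn0 (dvd_trans (by norm_num) hd)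
    have hm : m = 1 := Nat.dvd_one.1 (hprim.dvd_of_pow_eq_one 1 (by decide))
    subst hm
    have hk : 2 ≤ k := by
      by_contra hlt
      interval_cases k <;> omega
    obtain ⟨j, rfl⟩ : ∃ j, k = j + 2 := ⟨k - 2, by omega⟩
    have h1 := cyclotomic_eval_mul_dvd (q := 3) hn0 Nat.prime_two h2n
    have h9 : n / 2 = 2 * 2 ^ j := by rw [hnk, pow_add]; omega
    have h10 : n = 2 * (2 * 2 ^ j) := by rw [hnk, pow_add]; omega
    rw [h9] at h1
    conv_rhs at h1 => rw [h10, mul_comm 2, pow_mul]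
    have hne : ((3 : ℕ) : ℤ) ^ (2 * 2 ^ j) - 1 ≠ 0 :=
      sub_ne_zero.2 (one_lt_pow₀ (by norm_num) (by positivity)).ne'
    have h11 : (4 : ℤ) ∣ ((3 : ℕ) : ℤ) ^ (2 * 2 ^ j) + 1 := by
      refine hd.trans (Int.dvd_of_mul_dvd_mul_right hne (h1.trans (dvd_of_eq ?_)))
      ring
    rw [pow_mul] at h11
    have h12 : (4 : ℤ) ∣ (((3 : ℕ) : ℤ) ^ 2) ^ 2 ^ j - 1 := by
      refine dvd_trans ?_ (sub_one_dvd_pow_sub_one _ _)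
      norm_num
    omega
  obtain ⟨r, k, m, hr, hk, hnk, hrm, hprim, hval⟩ :=
    cyclotomic_eval_eq_prime (by norm_num) (by omega) h h2
  have h3 := sub_one_pow_totient_lt_cyclotomic_eval (n := n) (q := ((3 : ℕ) : ℝ)) (by omega)
    (by norm_num)
  rw [cyclotomic_eval_cast, hval] at h3
  norm_num at h3
  have h4 : 2 ^ n.totient < r := by exact_mod_cast h3
  have h5 : r - 1 ≤ n.totient := by
    rw [← Nat.totient_prime hr]
    exact Nat.le_of_dvd (Nat.totient_pos.2 hn0) (Nat.totient_dvd_of_dvd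
      (hnk ▸ (dvd_pow_self r hk.ne').mul_right m))
  have h6 : r - 1 < 2 ^ (r - 1) := Nat.lt_two_pow_self
  have h7 : 2 ^ (r - 1) ≤ 2 ^ n.totient := Nat.pow_le_pow_right (by norm_num) h5
  omega

/-- The lower bound (q-1)^φ(n) is empty for q = 2, so Φ_n(2) = r is rewritten through values at 2^r.
If r^2 divides n, then Φ_n(2) = Φ_{n/r}(2^r) ≥ 2^r - 1 > r. If n = rm with r not dividing m, then r
Φ_m(2) = Φ_m(2^r) ≥ (2^r - 1)^φ(m), while Φ_m(2) ≤ 3^φ(m); this is impossible once 2^r - 1 > 3r. -/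
theorem exists_isPrimitivePrime_two {n : ℕ} (hn : ¬ n ∣ 6) (hn0 : 0 < n) :
    ∃ r, IsPrimitivePrime 2 n r := by
  by_contra h
  have hn2 : 3 < n := by
    by_contra hlt
    interval_cases n <;> simp at hn
  have hodd : ∀ r : ℕ, r ∣ n → (r : ℤ) ∣ (cyclotomic n ℤ).eval ((2 : ℕ) : ℤ) → r ≠ 2 := by
    rintro r - hd rfl
    obtain ⟨k, m, -, hm, hprim⟩ := exists_order_of_dvd_cyclotomic hn0 hd
    have h0 : ((2 : ℕ) : ZMod 2) = 0 := by decide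
    have hm0 : m ≠ 0 := by rintro rfl; simp at hm
    have := hprim.pow_eq_one
    rw [h0, zero_pow hm0] at this
    exact zero_ne_one this
  obtain ⟨r, k, m, hr, hk, hnk, hrm, hprim, hval⟩ :=
    cyclotomic_eval_eq_prime (by norm_num) (by omega) h (fun h2 h4 =>
      hodd 2 h2 (dvd_trans (by norm_num) h4) rfl)
  have hrn : r ∣ n := hnk ▸ (dvd_pow_self r hk.ne').mul_right m
  have hr2 : r ≠ 2 := hodd r hrn (by rw [hval])
  have hm0 : 0 < m := Nat.pos_of_ne_zero (by rintro rfl; simp at hrm)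
  have hr3 : 3 ≤ r := by have := hr.two_le; omega
  have hrpow : (1 : ℝ) < 2 ^ r := one_lt_pow₀ (by norm_num) (by omega)
  have hcast := cyclotomic_eval_cast 2 n
  rw [hval] at hcast
  push_cast at hcast
  rcases Nat.lt_or_ge 1 k with hk1 | hk1
  · obtain ⟨j, rfl⟩ : ∃ j, k = j + 2 := ⟨k - 2, by omega⟩
    have hn' : n = r ^ (j + 1) * m * r := by rw [hnk]; ring
    have hexp := cyclotomic_expand_eq_cyclotomic hr
      ((dvd_pow_self r (Nat.succ_ne_zero j)).mul_right m) ℝ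
    rw [← hn'] at hexp
    have hev := congrArg (eval (2 : ℝ)) hexp
    rw [expand_eval, hcast] at hev
    have hle := sub_one_pow_totient_le_cyclotomic_eval hrpow (r ^ (j + 1) * m)
    rw [hev] at hle
    have h1 : (2 : ℝ) ^ r - 1 ≤ ((2 : ℝ) ^ r - 1) ^ Nat.totient (r ^ (j + 1) * m) := by
      refine le_self_pow₀ ?_ (Nat.totient_pos.2 (Nat.mul_pos (pow_pos hr.pos _) hm0)).ne'
      have : (2 : ℝ) ^ 1 ≤ 2 ^ r := pow_le_pow_right₀ (by norm_num) hr.one_lt.le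
      linarith
    have h2 : (2 : ℝ) ^ r ≤ r + 1 := by linarith
    have h3 : 2 ^ r ≤ r + 1 := by exact_mod_cast h2
    have h4 : r - 1 < 2 ^ (r - 1) := Nat.lt_two_pow_self
    have h5 : 2 ^ r = 2 * 2 ^ (r - 1) := by rw [← pow_succ', Nat.sub_add_cancel hr.one_lt.le]
    omega
  · obtain rfl : k = 0 + 1 := by omega
    rw [zero_add, pow_one] at hnk
    -- The exceptional value r = 3 is where the divisors of 6 come from: the order m of 2 modulo 3
    -- divides 2, so n = 3m divides 6.
    have hr5 : 5 ≤ r := by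
      by_contra hlt
      have : r = 3 ∨ r = 4 := by omega
      rcases this with rfl | rfl
      · have : m ∣ 2 := hprim.dvd_of_pow_eq_one 2 (by decide)
        exact hn (hnk ▸ mul_dvd_mul_left 3 this)
      · exact absurd hr (by decide)
    have hexp := cyclotomic_expand_eq_cyclotomic_mul hr hrm ℝ
    rw [mul_comm m, ← hnk] at hexp
    have hev := congrArg (eval (2 : ℝ)) hexp
    rw [expand_eval, eval_mul, hcast] at hev
    have hle := sub_one_pow_totient_le_cyclotomic_eval hrpow m
    have hle2 := cyclotomic_eval_le_add_one_pow_totient (q := 2) (by norm_num) m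
    have hφ : m.totient ≠ 0 := (Nat.totient_pos.2 hm0).ne'
    have h1 : (2 : ℝ) ^ r - 1 > 3 * r := by
      have : ∀ t : ℕ, 5 ≤ t → 3 * t + 1 < 2 ^ t := by
        intro t ht
        induction t, ht using Nat.le_induction with
        | base => norm_num
        | succ t ht ih => rw [pow_succ]; omega
      have : (3 : ℝ) * r + 1 < 2 ^ r := by exact_mod_cast this r hr5
      linarith
    have h2 : ((3 : ℝ) * r) ^ m.totient < ((2 : ℝ) ^ r - 1) ^ m.totient :=
      pow_lt_pow_left₀ h1 (by positivity) hφ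
    have h3 : (r : ℝ) ≤ (r : ℝ) ^ m.totient :=
      le_self_pow₀ (by exact_mod_cast hr.one_lt.le) hφ
    rw [mul_pow] at h2
    norm_num at hle2
    have h4 : (r : ℝ) * eval 2 (cyclotomic m ℝ) ≤ r ^ m.totient * 3 ^ m.totient :=
      mul_le_mul h3 hle2 (cyclotomic_nonneg m (by norm_num)) (by positivity)
    linarith

/-- The number `d_q`, for which `q ^ n - 1` has a primitive prime unless `n ∣ d_q`. -/
def IsZsigmondyBound (q d : ℕ) : Prop :=
  1 < q ∧ ∀ n, 0 < n → ¬ n ∣ d → ∃ r, IsPrimitivePrime q n r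

theorem isZsigmondyBound_two : IsZsigmondyBound 2 6 :=
  ⟨by norm_num, fun _ h0 h => exists_isPrimitivePrime_two h h0⟩

theorem isZsigmondyBound_three : IsZsigmondyBound 3 2 :=
  ⟨by norm_num, fun _ h0 h => exists_isPrimitivePrime_three h h0⟩

end PrimitivePrimes

/-! ### Equal products of numbers q^n - 1 -/

section Counting

theorem factorization_prod_map_pow_sub_one {q : ℕ} (hq : 1 < q) (r : ℕ) (A : Multiset ℕ)
    (hA : ∀ a ∈ A, 0 < a) :
    (A.map fun a => q ^ a - 1).prod.factorization r =
      ∑ n ∈ A.toFinset, A.count n * (q ^ n - 1).factorization r := by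
  have hne : ∀ a ∈ A, q ^ a - 1 ≠ 0 := fun a ha =>
    Nat.sub_ne_zero_of_lt (Nat.one_lt_pow (hA a ha).ne' hq)
  have : ∀ A : Multiset ℕ, (∀ a ∈ A, q ^ a - 1 ≠ 0) →
      (A.map fun a => q ^ a - 1).prod.factorization r =
        (A.map fun a => (q ^ a - 1).factorization r).sum := by
    intro A
    induction A using Multiset.induction_on with
    | empty => simp
    | cons a A ih =>
      intro h
      rw [Multiset.map_cons, Multiset.prod_cons, Nat.factorization_mul, Finsupp.add_apply,
        ih fun b hb => h b (Multiset.mem_cons_of_mem hb), Multiset.map_cons, Multiset.sum_cons]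
      · exact h a (Multiset.mem_cons_self a A)
      · refine Multiset.prod_ne_zero fun h0 => ?_
        obtain ⟨b, hb, hb0⟩ := Multiset.mem_map.1 h0
        exact h b (Multiset.mem_cons_of_mem hb) hb0
  rw [this A hne, Finset.sum_multiset_map_count]
  simp

theorem sum_count_mul_factorization_eq {q r : ℕ} (hq : 1 < q) {A B : Multiset ℕ}
    (hA : ∀ a ∈ A, 0 < a) (hB : ∀ b ∈ B, 0 < b)
    (h : (A.map fun a => q ^ a - 1).prod = (B.map fun b => q ^ b - 1).prod)
    {s : Finset ℕ} (hAs : A.toFinset ⊆ s) (hBs : B.toFinset ⊆ s) :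
    ∑ n ∈ s, A.count n * (q ^ n - 1).factorization r =
      ∑ n ∈ s, B.count n * (q ^ n - 1).factorization r := by
  rw [← Finset.sum_subset hAs, ← Finset.sum_subset hBs,
    ← factorization_prod_map_pow_sub_one hq r A hA, h, factorization_prod_map_pow_sub_one hq r B hB]
  · intro n _ hn
    rw [Multiset.count_eq_zero_of_notMem (by simpa using hn), zero_mul]
  · intro n _ hn
    rw [Multiset.count_eq_zero_of_notMem (by simpa using hn), zero_mul]

/-- Take the largest m not dividing d whose multiplicities differ, and a primitive prime r of q^m -
1. The numbers q^k - 1 divisible by r have m ∣ k, so k does not divide d, and by maximality the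
multiplicities agree for every such k ≠ m. Comparing r-adic valuations forces agreement at m as
well. -/
theorem count_eq_of_prod_eq {q d : ℕ} (hqd : IsZsigmondyBound q d) {A B : Multiset ℕ}
    (hA : ∀ a ∈ A, 0 < a) (hB : ∀ b ∈ B, 0 < b)
    (h : (A.map fun a => q ^ a - 1).prod = (B.map fun b => q ^ b - 1).prod)
    {n : ℕ} (hn : ¬ n ∣ d) : A.count n = B.count n := by
  by_contra hne
  set s := A.toFinset ∪ B.toFinset with hs
  set bad := s.filter fun n => ¬ n ∣ d ∧ A.count n ≠ B.count n with hbad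
  have hmem : ∀ m, A.count m ≠ B.count m → m ∈ s := by
    intro m hm
    by_contra hms
    simp only [hs, Finset.mem_union, Multiset.mem_toFinset, not_or] at hms
    exact hm (by rw [Multiset.count_eq_zero_of_notMem hms.1, Multiset.count_eq_zero_of_notMem hms.2])
  have hnb : bad.Nonempty := ⟨n, by simp [hbad, hmem n hne, hn, hne]⟩
  obtain ⟨m, hm, hmax⟩ := bad.exists_max_image id hnb
  simp only [hbad, Finset.mem_filter] at hm
  have hpos : ∀ k ∈ s, 0 < k := by
    intro k hk
    simp only [hs, Finset.mem_union, Multiset.mem_toFinset] at hk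
    exact hk.elim (hA k) (hB k)
  obtain ⟨r, hr, hrm, hprim⟩ := hqd.2 m (hpos m hm.1) hm.2.1
  have key := sum_count_mul_factorization_eq (r := r) hqd.1 hA hB h (s := s)
    Finset.subset_union_left Finset.subset_union_right
  rw [← Finset.add_sum_erase _ _ hm.1, ← Finset.add_sum_erase s _ hm.1] at key
  have hrest : ∑ k ∈ s.erase m, A.count k * (q ^ k - 1).factorization r =
      ∑ k ∈ s.erase m, B.count k * (q ^ k - 1).factorization r := by
    refine Finset.sum_congr rfl fun k hk => ?_
    rw [Finset.mem_erase] at hk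
    by_cases hrk : r ∣ q ^ k - 1
    · have hmk := hprim k hrk
      have hkd : ¬ k ∣ d := fun hkd => hm.2.1 (hmk.trans hkd)
      by_cases hc : A.count k = B.count k
      · rw [hc]
      · have h1 : k ≤ m := hmax k (by simp [hbad, hk.2, hkd, hc])
        have h2 := Nat.le_of_dvd (hpos k hk.2) hmk
        exact absurd (le_antisymm h1 h2) hk.1
    · rw [Nat.factorization_eq_zero_of_not_dvd hrk, mul_zero, mul_zero]
  have hfpos : 0 < (q ^ m - 1).factorization r :=
    hr.factorization_pos_of_dvd
      (Nat.sub_ne_zero_of_lt (Nat.one_lt_pow (hpos m hm.1).ne' hqd.1)) hrm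
  rw [hrest] at key
  exact hm.2.2 (Nat.eq_of_mul_eq_mul_right hfpos (Nat.add_right_cancel key))

/-- All terms with n not dividing d cancel, so any prime r yields a linear relation among the
finitely many multiplicities at divisors of d. The bounds on the number of chains rest on these
relations. -/
theorem sum_divisors_count_mul_factorization_eq {q d : ℕ} (hqd : IsZsigmondyBound q d)
    (hd : d ≠ 0) {A B : Multiset ℕ}
    (hA : ∀ a ∈ A, 0 < a) (hB : ∀ b ∈ B, 0 < b)
    (h : (A.map fun a => q ^ a - 1).prod = (B.map fun b => q ^ b - 1).prod) (r : ℕ) :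
    ∑ n ∈ d.divisors, A.count n * (q ^ n - 1).factorization r =
      ∑ n ∈ d.divisors, B.count n * (q ^ n - 1).factorization r := by
  set s := A.toFinset ∪ B.toFinset ∪ d.divisors with hs
  have key := sum_count_mul_factorization_eq (r := r) hqd.1 hA hB h (s := s)
    (fun x hx => by simp_all) (fun x hx => by simp_all)
  have hsub : d.divisors ⊆ s := Finset.subset_union_right
  rw [← Finset.sum_sdiff hsub, ← Finset.sum_sdiff hsub] at key
  rw [Finset.sum_congr rfl (g := fun n => B.count n * (q ^ n - 1).factorization r)] at key
  · exact Nat.add_left_cancel key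
  · intro n hn
    have : ¬ n ∣ d := fun hnd => (Finset.mem_sdiff.1 hn).2 (Nat.mem_divisors.2 ⟨hnd, hd⟩)
    rw [count_eq_of_prod_eq hqd hA hB h this]

end Counting

end PhiSigma

namespace PhiSigma

/-! ### Multiplicativity of φ and σ, and their values at prime powers -/

section Multiplicative

open Polynomial UniqueFactorizationMonoid

variable {K : Type*} [Field K]

theorem exists_monic_factorization {G : K[X]} (hG : G ≠ 0) :
    ∃ (S : Finset K[X]) (e : K[X] → ℕ) (c : K), c ≠ 0 ∧
      (∀ P ∈ S, P.Monic ∧ Irreducible P ∧ 0 < e P) ∧ G = C c * ∏ P ∈ S, P ^ e P := by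
  classical
  obtain ⟨u, hu⟩ := (prod_normalizedFactors hG)
  obtain ⟨c, hc, hcu⟩ := Polynomial.isUnit_iff.1 u.isUnit
  refine ⟨(normalizedFactors G).toFinset, fun P => (normalizedFactors G).count P, c,
    hc.ne_zero, ?_, ?_⟩
  · intro P hP
    rw [Multiset.mem_toFinset] at hP
    have hirr := irreducible_of_normalized_factor P hP
    refine ⟨?_, hirr, Multiset.count_pos.2 hP⟩
    rw [← normalize_normalized_factor P hP]
    exact monic_normalize hirr.ne_zero
  · rw [← Finset.prod_multiset_count, hcu, mul_comm, hu]

theorem isCoprime_of_monic_irreducible {P Q : K[X]} (hP : P.Monic) (hQ : Q.Monic)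
    (hP' : Irreducible P) (hQ' : Irreducible Q) (h : P ≠ Q) : IsCoprime P Q :=
  (hP'.coprime_iff_not_dvd).2 fun hd =>
    h (eq_of_monic_of_associated hP hQ (hP'.associated_of_dvd hQ' hd))

theorem finite_setOf_natDegree_le [Finite K] (n : ℕ) : {A : K[X] | A.natDegree ≤ n}.Finite := by
  have : Finite (degreeLT K (n + 1)) := Finite.of_equiv _ (degreeLTEquiv K (n + 1)).symm.toEquiv
  refine (Set.toFinite (degreeLT K (n + 1) : Set K[X])).subset fun A hA => ?_
  rw [SetLike.mem_coe, mem_degreeLT]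
  exact lt_of_le_of_lt degree_le_natDegree (by exact_mod_cast Nat.lt_succ_of_le hA)

theorem finite_monic_divisors [Finite K] {G : K[X]} (hG : G ≠ 0) :
    {D : K[X] | D.Monic ∧ D ∣ G}.Finite :=
  (finite_setOf_natDegree_le G.natDegree).subset fun _ hD => natDegree_le_of_dvd hD.2 hG

theorem norm_mul {A B : K[X]} (hA : A ≠ 0) (hB : B ≠ 0) :
    norm K (A * B) = norm K A * norm K B := by
  rw [norm, natDegree_mul hA hB, pow_add, norm, norm]

theorem sigma_eq_of_associated {A B : K[X]} (h : Associated A B) : sigma K A = sigma K B := by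
  simp only [sigma, h.dvd_iff_dvd_right]

theorem sigma_mul [Finite K] {A B : K[X]} (hA : A ≠ 0) (hB : B ≠ 0) (h : IsCoprime A B) :
    sigma K (A * B) = sigma K A * sigma K B := by
  classical
  have himg : {D : K[X] | D.Monic ∧ D ∣ A * B} =
      (fun p : K[X] × K[X] => p.1 * p.2) ''
        ({D : K[X] | D.Monic ∧ D ∣ A} ×ˢ {D : K[X] | D.Monic ∧ D ∣ B}) := by
    ext D
    simp only [Set.mem_ofPred_eq, Set.mem_image, Set.mem_prod, Prod.exists]
    constructor
    · rintro ⟨hD, hdvd⟩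
      obtain ⟨a, b, ha, hb, rfl⟩ := exists_dvd_and_dvd_of_dvd_mul hdvd
      have ha0 : a ≠ 0 := ne_zero_of_dvd_ne_zero hA ha
      have hb0 : b ≠ 0 := ne_zero_of_dvd_ne_zero hB hb
      refine ⟨normalize a, normalize b, ⟨⟨monic_normalize ha0, normalize_dvd_iff.2 ha⟩,
        monic_normalize hb0, normalize_dvd_iff.2 hb⟩, ?_⟩
      rw [← normalize_mul, hD.normalize_eq_self]
    · rintro ⟨a, b, ⟨⟨ha, ha'⟩, hb, hb'⟩, rfl⟩
      exact ⟨ha.mul hb, mul_dvd_mul ha' hb'⟩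
  have hinj : Set.InjOn (fun p : K[X] × K[X] => p.1 * p.2)
      ({D : K[X] | D.Monic ∧ D ∣ A} ×ˢ {D : K[X] | D.Monic ∧ D ∣ B}) := by
    rintro ⟨a, b⟩ ⟨⟨ha, ha'⟩, hb, hb'⟩ ⟨c, d⟩ ⟨⟨hc, hc'⟩, hd, hd'⟩ heq
    simp only at ha ha' hb hb' hc hc' hd hd' heq
    have hac : a = c := by
      refine eq_of_monic_of_associated ha hc (associated_of_dvd_dvd ?_ ?_)
      · exact (h.of_isCoprime_of_dvd_left ha' |>.of_isCoprime_of_dvd_right hd').dvd_of_dvd_mul_right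
          (heq ▸ dvd_mul_right a b)
      · exact (h.of_isCoprime_of_dvd_left hc' |>.of_isCoprime_of_dvd_right hb').dvd_of_dvd_mul_right
          (heq.symm ▸ dvd_mul_right c d)
    subst hac
    exact Prod.ext rfl (mul_left_cancel₀ ha.ne_zero heq)
  have hfA := finite_monic_divisors hA
  have hfB := finite_monic_divisors hB
  rw [sigma, himg, finsum_mem_image hinj, finsum_mem_eq_finite_toFinset_sum _ (hfA.prod hfB),
    ← Set.Finite.toFinset_prod hfA hfB, Finset.sum_product, sigma, sigma,
    finsum_mem_eq_finite_toFinset_sum _ hfA, finsum_mem_eq_finite_toFinset_sum _ hfB,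
    Finset.sum_mul_sum]
  refine Finset.sum_congr rfl fun a ha => Finset.sum_congr rfl fun b hb => ?_
  rw [Set.Finite.mem_toFinset] at ha hb
  exact norm_mul ha.1.ne_zero hb.1.ne_zero

theorem sigma_pow {P : K[X]} (hP : P.Monic) (hirr : Irreducible P) (e : ℕ) :
    sigma K (P ^ e) = ∑ i ∈ Finset.range (e + 1), (Nat.card K ^ P.natDegree) ^ i := by
  have himg : {D : K[X] | D.Monic ∧ D ∣ P ^ e} = (P ^ ·) '' (Finset.range (e + 1) : Set ℕ) := by
    ext D
    simp only [Set.mem_ofPred_eq, Set.mem_image, Finset.coe_range, Set.mem_Iio]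
    constructor
    · rintro ⟨hD, hdvd⟩
      obtain ⟨i, hi, hass⟩ := (dvd_prime_pow hirr.prime e).1 hdvd
      exact ⟨i, by omega, (eq_of_monic_of_associated hD (hP.pow i) hass).symm⟩
    · rintro ⟨i, hi, rfl⟩
      exact ⟨hP.pow i, pow_dvd_pow P (by omega)⟩
  have hinj : Set.InjOn (P ^ ·) (Finset.range (e + 1) : Set ℕ) := by
    intro i _ j _ hij
    have := congrArg natDegree hij
    simp only [natDegree_pow] at this
    exact Nat.eq_of_mul_eq_mul_right hirr.natDegree_pos this
  rw [sigma, himg, finsum_mem_image hinj, finsum_mem_coe_finset]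
  refine Finset.sum_congr rfl fun i _ => ?_
  rw [norm, natDegree_pow, mul_comm, pow_mul]

theorem pow_sub_one_mul_sigma_pow [Finite K] {P : K[X]} (hP : P.Monic) (hirr : Irreducible P)
    (e : ℕ) : (Nat.card K ^ P.natDegree - 1) * sigma K (P ^ e) =
      Nat.card K ^ ((e + 1) * P.natDegree) - 1 := by
  rw [sigma_pow hP hirr, mul_comm (e + 1), pow_mul]
  have h1 : 1 ≤ Nat.card K ^ P.natDegree := Nat.one_le_pow _ _ Nat.card_pos
  zify [h1, Nat.one_le_pow (e + 1) _ h1]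
  exact mul_geom_sum _ _

theorem sigma_one : sigma K (1 : K[X]) = 1 := by
  have : {D : K[X] | D.Monic ∧ D ∣ 1} = {1} := by
    ext D
    simp only [Set.mem_ofPred_eq, Set.mem_singleton_iff]
    constructor
    · rintro ⟨hD, h⟩
      exact hD.eq_one_of_isUnit (isUnit_of_dvd_one h)
    · rintro rfl
      exact ⟨monic_one, dvd_rfl⟩
  rw [sigma, this, finsum_mem_singleton, norm, natDegree_one, pow_zero]

theorem sigma_prod [Finite K] {ι : Type*} (s : Finset ι) (f : ι → K[X]) (h0 : ∀ i ∈ s, f i ≠ 0)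
    (hc : ∀ i ∈ s, ∀ j ∈ s, i ≠ j → IsCoprime (f i) (f j)) :
    sigma K (∏ i ∈ s, f i) = ∏ i ∈ s, sigma K (f i) := by
  classical
  induction s using Finset.induction_on with
  | empty => simp [sigma_one]
  | insert a s ha ih =>
    rw [Finset.prod_insert ha, Finset.prod_insert ha, sigma_mul, ih]
    · exact fun i hi => h0 i (Finset.mem_insert_of_mem hi)
    · exact fun i hi j hj => hc i (Finset.mem_insert_of_mem hi) j (Finset.mem_insert_of_mem hj)
    · exact h0 a (Finset.mem_insert_self a s)
    · exact Finset.prod_ne_zero_iff.2 fun i hi => h0 i (Finset.mem_insert_of_mem hi)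
    · exact IsCoprime.prod_right fun i hi => hc a (Finset.mem_insert_self a s) i
        (Finset.mem_insert_of_mem hi) (by rintro rfl; exact ha hi)

theorem phi_eq_of_associated {A B : K[X]} (h : Associated A B) : phi K A = phi K B := by
  rw [phi, phi, Ideal.span_singleton_eq_span_singleton.2 h]

theorem phi_mul {A B : K[X]} (h : IsCoprime A B) : phi K (A * B) = phi K A * phi K B := by
  have hc : IsCoprime (Ideal.span {A}) (Ideal.span {B}) := by
    rwa [Ideal.isCoprime_span_singleton_iff]
  have e := (Ideal.quotientMulEquivQuotientProd _ _ hc)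
  rw [phi, phi, phi, ← Ideal.span_singleton_mul_span_singleton, ← Nat.card_prod]
  exact Nat.card_congr ((Units.mapEquiv e.toMulEquiv).trans MulEquiv.prodUnits).toEquiv

theorem phi_one : phi K (1 : K[X]) = 1 := by
  have : Subsingleton (K[X] ⧸ Ideal.span {(1 : K[X])}) :=
    Ideal.Quotient.subsingleton_iff.2 Ideal.span_singleton_one
  rw [phi, Nat.card_unique]

theorem phi_prod {ι : Type*} (s : Finset ι) (f : ι → K[X])
    (hc : ∀ i ∈ s, ∀ j ∈ s, i ≠ j → IsCoprime (f i) (f j)) :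
    phi K (∏ i ∈ s, f i) = ∏ i ∈ s, phi K (f i) := by
  classical
  induction s using Finset.induction_on with
  | empty => simp [phi_one]
  | insert a s ha ih =>
    rw [Finset.prod_insert ha, Finset.prod_insert ha, phi_mul, ih]
    · exact fun i hi j hj => hc i (Finset.mem_insert_of_mem hi) j (Finset.mem_insert_of_mem hj)
    · exact IsCoprime.prod_right fun i hi => hc a (Finset.mem_insert_self a s) i
        (Finset.mem_insert_of_mem hi) (by rintro rfl; exact ha hi)

theorem phi_irreducible [Finite K] {P : K[X]} (hP : Irreducible P) :
    phi K P = Nat.card K ^ P.natDegree - 1 := by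
  have : (Ideal.span {P}).IsMaximal := PrincipalIdealRing.isMaximal_of_irreducible hP
  let _ := Ideal.Quotient.field (Ideal.span {P})
  have hfin : Module.Finite K (K[X] ⧸ Ideal.span {P}) :=
    Module.finite_of_finrank_pos (by
      rw [finrank_quotient_span_eq_natDegree]; exact hP.natDegree_pos)
  rw [phi, Nat.card_units, Module.natCard_eq_pow_finrank (K := K),
    finrank_quotient_span_eq_natDegree]

theorem finite_quotient [Finite K] {F : K[X]} (hF : F ≠ 0) :
    Finite (K[X] ⧸ Ideal.span {F}) := by
  have : Module.Finite K (K[X] ⧸ Ideal.span {F}) := by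
    have := (AdjoinRoot.powerBasis hF).finite
    exact this
  exact Module.finite_of_finite K

/-- Write F = P^2 H. The class x of PH is nonzero with square zero, so (1 + x)^p = 1 + x^p = 1 and 1
+ x is a unit of order p. -/
theorem ringChar_dvd_phi_of_sq_dvd [Finite K] {p : ℕ} [CharP K p] [hp : Fact p.Prime]
    {F P : K[X]} (hF : F ≠ 0) (hP : Irreducible P) (h : P ^ 2 ∣ F) : p ∣ phi K F := by
  obtain ⟨H, rfl⟩ := h
  have := finite_quotient hF
  set R := K[X] ⧸ Ideal.span {P ^ 2 * H}
  set x : R := Ideal.Quotient.mk _ (P * H) with hx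
  have hx0 : x ≠ 0 := by
    rw [hx, Ne, Ideal.Quotient.eq_zero_iff_mem, Ideal.mem_span_singleton]
    intro hd
    have hPH : P * H ≠ 0 := by
      intro h0; apply hF; rw [pow_two, mul_assoc, h0, mul_zero]
    rw [pow_two, mul_assoc] at hd
    have : P ∣ 1 := by
      refine (mul_dvd_mul_iff_right hPH).1 ?_
      rwa [one_mul]
    exact hP.not_isUnit (isUnit_of_dvd_one this)
  have hx2 : x ^ 2 = 0 := by
    rw [hx, ← map_pow, Ideal.Quotient.eq_zero_iff_mem, Ideal.mem_span_singleton]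
    exact ⟨H, by ring⟩
  have hnt : Nontrivial R := ⟨x, 0, hx0⟩
  have hchar : CharP R p := charP_of_injective_algebraMap (algebraMap K R).injective p
  have hpow : (1 + x) ^ p = 1 := by
    rw [add_pow_char, one_pow, ← Nat.sub_add_cancel hp.out.two_le, pow_add, hx2, mul_zero,
      add_zero]
  let u : Rˣ := Units.ofPowEqOne (1 + x) p hpow hp.out.ne_zero
  have hu : orderOf u = p := by
    refine orderOf_eq_prime (Units.pow_ofPowEqOne hpow hp.out.ne_zero) fun h1 => hx0 ?_
    have := congrArg Units.val h1
    simpa [u] using this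
  rw [phi, ← hu]
  exact orderOf_dvd_natCard u

end Multiplicative
end PhiSigma

namespace PhiSigma

/-! ### φ and σ in terms of factorizations into monic primes -/

section Factorizations

open Polynomial

variable {K : Type*} [Field K]

/-- `G` is a constant times `∏ P ^ e P` over the finite set `S` of monic primes. -/
structure IsFactorization (G : K[X]) (S : Finset K[X]) (e : K[X] → ℕ) : Prop where
  monic : ∀ P ∈ S, P.Monic
  irreducible : ∀ P ∈ S, Irreducible P
  pos : ∀ P ∈ S, 0 < e P
  eq_prod : ∃ c : K, c ≠ 0 ∧ G = C c * ∏ P ∈ S, P ^ e P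

theorem exists_isFactorization {G : K[X]} (hG : G ≠ 0) : ∃ S e, IsFactorization G S e := by
  obtain ⟨S, e, c, hc, h, rfl⟩ := exists_monic_factorization hG
  exact ⟨S, e, fun P hP => (h P hP).1, fun P hP => (h P hP).2.1, fun P hP => (h P hP).2.2,
    c, hc, rfl⟩

namespace IsFactorization

variable {G : K[X]} {S : Finset K[X]} {e : K[X] → ℕ}

theorem associated (h : IsFactorization G S e) : Associated G (∏ P ∈ S, P ^ e P) := by
  obtain ⟨c, hc, hG⟩ := h.eq_prod
  rw [hG]
  exact associated_unit_mul_left _ _ (isUnit_C.2 (isUnit_iff_ne_zero.2 hc))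

theorem ne_zero (h : IsFactorization G S e) : G ≠ 0 := by
  rw [Ne, h.associated.eq_zero_iff]
  exact Finset.prod_ne_zero_iff.2 fun P hP => pow_ne_zero _ (h.irreducible P hP).ne_zero

theorem isCoprime (h : IsFactorization G S e) {P Q : K[X]} (hP : P ∈ S) (hQ : Q ∈ S)
    (hPQ : P ≠ Q) : IsCoprime P Q :=
  isCoprime_of_monic_irreducible (h.monic P hP) (h.monic Q hQ) (h.irreducible P hP)
    (h.irreducible Q hQ) hPQ

theorem isCoprime_pow (h : IsFactorization G S e) {P Q : K[X]} (hP : P ∈ S) (hQ : Q ∈ S)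
    (hPQ : P ≠ Q) : IsCoprime (P ^ e P) (Q ^ e Q) :=
  (h.isCoprime hP hQ hPQ).pow

theorem dvd_of_mem (h : IsFactorization G S e) {P : K[X]} (hP : P ∈ S) : P ∣ G :=
  ((dvd_pow_self P (h.pos P hP).ne').trans (Finset.dvd_prod_of_mem (fun P => P ^ e P) hP)).trans
    h.associated.symm.dvd

theorem pow_dvd (h : IsFactorization G S e) {P : K[X]} (hP : P ∈ S) : P ^ e P ∣ G :=
  (Finset.dvd_prod_of_mem (fun P => P ^ e P) hP).trans h.associated.symm.dvd

theorem not_pow_succ_dvd (h : IsFactorization G S e) {P : K[X]} (hP : P ∈ S) :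
    ¬ P ^ (e P + 1) ∣ G := by
  classical
  intro hd
  have hd' := hd.trans h.associated.dvd
  rw [← Finset.mul_prod_erase S _ hP, pow_succ] at hd'
  have hdvd := (mul_dvd_mul_iff_left (pow_ne_zero _ (h.irreducible P hP).ne_zero)).1 hd'
  have hc : IsCoprime P (∏ Q ∈ S.erase P, Q ^ e Q) := IsCoprime.prod_right fun Q hQ =>
    (h.isCoprime hP (Finset.mem_of_mem_erase hQ) (Finset.ne_of_mem_erase hQ).symm).pow_right
  exact (h.irreducible P hP).not_isUnit (hc.isUnit_of_dvd' dvd_rfl hdvd)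

theorem exists_associated_of_dvd (h : IsFactorization G S e) {P : K[X]} (hP : Irreducible P)
    (hd : P ∣ G) : ∃ Q ∈ S, Associated P Q := by
  have hd' := hd.trans h.associated.dvd
  obtain ⟨Q, hQ, hPQ⟩ := hP.prime.exists_mem_finset_dvd hd'
  exact ⟨Q, hQ, hP.associated_of_dvd (h.irreducible Q hQ) (hP.prime.dvd_of_dvd_pow hPQ)⟩

variable [Finite K]

theorem sigma_eq (h : IsFactorization G S e) : sigma K G = ∏ P ∈ S, sigma K (P ^ e P) := by
  rw [sigma_eq_of_associated h.associated, sigma_prod]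
  · exact fun P hP => pow_ne_zero _ (h.irreducible P hP).ne_zero
  · exact fun P hP Q hQ hPQ => h.isCoprime_pow hP hQ hPQ

theorem prod_mul_sigma_eq (h : IsFactorization G S e) :
    (∏ P ∈ S, (Nat.card K ^ P.natDegree - 1)) * sigma K G =
      ∏ P ∈ S, (Nat.card K ^ ((e P + 1) * P.natDegree) - 1) := by
  rw [h.sigma_eq, ← Finset.prod_mul_distrib]
  exact Finset.prod_congr rfl fun P hP =>
    pow_sub_one_mul_sigma_pow (h.monic P hP) (h.irreducible P hP) _

theorem phi_eq (h : IsFactorization G S e) (he : ∀ P ∈ S, e P = 1) :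
    phi K G = ∏ P ∈ S, (Nat.card K ^ P.natDegree - 1) := by
  rw [phi_eq_of_associated h.associated, phi_prod]
  · exact Finset.prod_congr rfl fun P hP => by
      rw [he P hP, pow_one, phi_irreducible (h.irreducible P hP)]
  · exact fun P hP Q hQ hPQ => h.isCoprime_pow hP hQ hPQ

/-- Each σ(P^e) is a geometric sum 1 + q^deg P + ⋯, hence 1 modulo p. -/
theorem not_dvd_sigma (h : IsFactorization G S e) {p : ℕ} (hp : p.Prime)
    (hpK : p ∣ Nat.card K) : ¬ p ∣ sigma K G := by
  rw [h.sigma_eq]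
  intro hd
  obtain ⟨P, hP, hd⟩ := (Prime.dvd_finsetProd_iff hp.prime _).1 hd
  rw [sigma_pow (h.monic P hP) (h.irreducible P hP), Finset.sum_range_succ', pow_zero,
    ← Nat.dvd_add_iff_right] at hd
  · exact hp.one_lt.ne' (Nat.dvd_one.1 hd)
  · refine Finset.dvd_sum fun i _ => ?_
    exact dvd_pow (hpK.trans (dvd_pow_self _ (h.irreducible P hP).natDegree_pos.ne'))
      (Nat.succ_ne_zero i)

end IsFactorization

theorem sigma_pos [Finite K] {G : K[X]} (hG : G ≠ 0) : 0 < sigma K G := by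
  obtain ⟨S, e, h⟩ := exists_isFactorization hG
  obtain ⟨p, hp, hpK⟩ := Nat.exists_prime_and_dvd (Finite.one_lt_card (α := K)).ne'
  refine Nat.pos_of_ne_zero fun h0 => h.not_dvd_sigma hp hpK ?_
  rw [h0]
  exact dvd_zero p

/-- The left side of `φ(F) ∏ (q ^ m - 1) = σ(G)` forces `F` to be squarefree. -/
theorem exponent_eq_one_of_phi_mul_eq_sigma [Finite K] {F G : K[X]} {S : Finset K[X]}
    {f : K[X] → ℕ} {N : ℕ} (hF : IsFactorization F S f) (hG : G ≠ 0)
    (h : phi K F * N = sigma K G) : ∀ P ∈ S, f P = 1 := by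
  intro P hP
  by_contra hne
  obtain ⟨T, e, hT⟩ := exists_isFactorization hG
  obtain ⟨p, hp⟩ := CharP.exists K
  have : Fact p.Prime := ⟨CharP.char_is_prime K p⟩
  have hpK : p ∣ Nat.card K := by
    have := Fintype.ofFinite K
    obtain ⟨n, -, hn⟩ := FiniteField.card K p
    rw [Nat.card_eq_fintype_card, hn]
    exact dvd_pow_self p n.ne_zero
  have h2 : 2 ≤ f P := by have := hF.pos P hP; omega
  exact hT.not_dvd_sigma Fact.out hpK (h ▸ (ringChar_dvd_phi_of_sq_dvd hF.ne_zero
    (hF.irreducible P hP) ((pow_dvd_pow P h2).trans (hF.pow_dvd hP))).mul_right N)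

/-- The equation `φ(F) ∏ (q ^ m - 1) = σ(G)` as an equality of products of terms `q ^ n - 1`. -/
theorem prod_pow_sub_one_eq [Finite K] {F G : K[X]} {S T : Finset K[X]} {f e : K[X] → ℕ}
    {M : Multiset ℕ} (hF : IsFactorization F S f) (hG : IsFactorization G T e)
    (h : phi K F * (M.map fun a => Nat.card K ^ a - 1).prod = sigma K G) :
    ((S.val.map natDegree + T.val.map natDegree + M).map fun a => Nat.card K ^ a - 1).prod =
      ((T.val.map fun P => (e P + 1) * P.natDegree).map fun a => Nat.card K ^ a - 1).prod := by
  have h1 := exponent_eq_one_of_phi_mul_eq_sigma hF hG.ne_zero h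
  rw [hF.phi_eq h1] at h
  have h2 := hG.prod_mul_sigma_eq
  rw [← h] at h2
  simp only [Multiset.map_add, Multiset.prod_add, Multiset.map_map, Function.comp_def]
  change (∏ P ∈ S, (Nat.card K ^ P.natDegree - 1)) * (∏ P ∈ T, (Nat.card K ^ P.natDegree - 1)) *
    (M.map fun a => Nat.card K ^ a - 1).prod = ∏ P ∈ T, (Nat.card K ^ ((e P + 1) * P.natDegree) - 1)
  rw [← h2]
  ring

theorem count_map_val {α : Type*} (S : Finset α) (f : α → ℕ) (n : ℕ) :
    (S.val.map f).count n = (S.filter fun P => f P = n).card := by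
  rw [Multiset.count_map, Finset.card_def, Finset.filter_val]
  simp only [eq_comm]

end Factorizations

/-! ### Telescoping along chains -/

section Chains

open Polynomial

theorem ExpTuple.deg_one (v : ExpTuple) : v.deg 1 = v.val 0 := by simp [ExpTuple.deg]

theorem ExpTuple.deg_succ (v : ExpTuple) {k : ℕ} (hk : 1 ≤ k) :
    v.deg (k + 1) = (v.val k + 1) * v.deg k := by
  rw [ExpTuple.deg, Finset.prod_Ico_succ_top hk, ExpTuple.deg]
  ring

theorem ExpTuple.deg_pos (v : ExpTuple) (k : ℕ) : 0 < v.deg k :=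
  Nat.mul_pos (v.val_pos 0 (Nat.zero_le _)) (Finset.prod_pos fun _ _ => Nat.succ_pos _)

theorem ExpTuple.deg_lt (v : ExpTuple) {j k : ℕ} (hj : 1 ≤ j) (hjk : j < k) (hk : k ≤ v.len + 1) :
    v.deg j < v.deg k := by
  induction k, hjk using Nat.le_induction with
  | base =>
    rw [Nat.succ_eq_add_one, v.deg_succ hj]
    have := v.deg_pos j
    have := v.val_pos j (by omega)
    nlinarith
  | succ k hjk ih =>
    refine (ih (by omega)).trans ?_
    rw [v.deg_succ (by omega)]
    have := v.deg_pos k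
    have := v.val_pos k (by omega)
    nlinarith

theorem ExpTuple.deg_inj (v : ExpTuple) {j k : ℕ} (hj : j ∈ Finset.Icc 1 (v.len + 1))
    (hk : k ∈ Finset.Icc 1 (v.len + 1)) (h : v.deg j = v.deg k) : j = k := by
  rw [Finset.mem_Icc] at hj hk
  rcases lt_trichotomy j k with hlt | rfl | hlt
  · exact absurd h (v.deg_lt hj.1 hlt hk.2).ne
  · rfl
  · exact absurd h (v.deg_lt hk.1 hlt hj.2).ne'

variable {K : Type*} [Field K]

/-- The target of P_k is the degree of P_{k+1}, so σ(P_k^v_k) = (q^deg P_{k+1} - 1)/(q^deg P_k - 1)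
and the product over the chain telescopes. -/
theorem pow_sub_one_mul_sigma_eq_phi [Finite K] {v : ExpTuple} {A B : K[X]}
    (h : (A, B) ∈ chainSet K v) :
    (Nat.card K ^ v.val 0 - 1) * sigma K B = phi K A := by
  obtain ⟨P, hP, hA, hB⟩ := h
  simp only at hA hB
  subst hA hB
  have hlast := hP (v.len + 1) (by simp)
  rw [phi_irreducible hlast.2.1, hlast.2.2]
  have key : ∀ k ≤ v.len, (Nat.card K ^ v.val 0 - 1) *
      ∏ j ∈ Finset.Icc 1 k, sigma K (P j ^ v.val j) = Nat.card K ^ v.deg (k + 1) - 1 := by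
    intro k hk
    induction k with
    | zero => simp [v.deg_one]
    | succ k ih =>
      obtain ⟨hm, hi, hd⟩ := hP (k + 1) (by rw [Finset.mem_Icc]; omega)
      rw [Finset.prod_Icc_succ_top (by omega), ← mul_assoc, ih (by omega), ← hd,
        pow_sub_one_mul_sigma_pow hm hi, hd, ← v.deg_succ (by omega)]
  rw [← key v.len le_rfl, sigma_prod]
  · intro j hj
    exact pow_ne_zero _ (hP j (Finset.Icc_subset_Icc_right (by omega) hj)).2.1.ne_zero
  · intro j hj k hk hjk
    have hj' := Finset.Icc_subset_Icc_right (show v.len ≤ v.len + 1 by omega) hj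
    have hk' := Finset.Icc_subset_Icc_right (show v.len ≤ v.len + 1 by omega) hk
    obtain ⟨hm, hi, hd⟩ := hP j hj'
    obtain ⟨hm', hi', hd'⟩ := hP k hk'
    refine (isCoprime_of_monic_irreducible hm hm' hi hi' fun h => hjk ?_).pow
    exact v.deg_inj hj' hk' (by rw [← hd, ← hd', h])

theorem ne_zero_of_mem_chainSet {v : ExpTuple} {A B : K[X]} (h : (A, B) ∈ chainSet K v) :
    A ≠ 0 ∧ B ≠ 0 := by
  obtain ⟨P, hP, hA, hB⟩ := h
  simp only at hA hB
  subst hA hB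
  refine ⟨(hP _ (by simp)).2.1.ne_zero, Finset.prod_ne_zero_iff.2 fun k hk => pow_ne_zero _ ?_⟩
  exact (hP k (Finset.Icc_subset_Icc_right (by omega) hk)).2.1.ne_zero

/-- A chain enters the equation only through the degree of its first prime, so the problem reduces
to (F_0, G_0). Used in one direction for the bounds and in the other for the constructions. -/
theorem IsDecomposition.phi_eq_sigma_iff [Finite K] {d n : ℕ} {F G : K[X]}
    {v : Fin n → ExpTuple} {A B : Fin (n + 1) → K[X]} (h : IsDecomposition d F G v A B)
    (hB : B 0 ≠ 0) :
    phi K F = sigma K G ↔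
      phi K (A 0) * ∏ i, (Nat.card K ^ (v i).val 0 - 1) = sigma K (B 0) := by
  have hne : ∀ i, B i ≠ 0 := Fin.cases hB fun i => (ne_zero_of_mem_chainSet (h.mem_chainSet i)).2
  have h1 : phi K F = phi K (A 0) * (∏ i, (Nat.card K ^ (v i).val 0 - 1)) *
      ∏ i : Fin n, sigma K (B i.succ) := by
    rw [h.prod_left, phi_prod _ _ fun i _ j _ => h.coprime_left i j, Fin.prod_univ_succ, mul_assoc,
      ← Finset.prod_mul_distrib]
    congr 1
    exact Finset.prod_congr rfl fun i _ => (pow_sub_one_mul_sigma_eq_phi (h.mem_chainSet i)).symm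
  have h2 : sigma K G = sigma K (B 0) * ∏ i : Fin n, sigma K (B i.succ) := by
    rw [h.prod_right, sigma_prod _ _ (fun i _ => hne i) fun i _ j _ => h.coprime_right i j,
      Fin.prod_univ_succ]
  rw [h1, h2]
  refine Nat.mul_left_inj (Finset.prod_ne_zero_iff.2 fun i _ => (sigma_pos (hne _)).ne')

end Chains

/-! ### Bounds on the number of chains -/

section Bounds

open Polynomial

variable {K : Type*} [Field K]

theorem card_linear_le [Finite K] (U : Finset K[X])
    (hU : ∀ P ∈ U, P.Monic ∧ Irreducible P ∧ P.natDegree = 1) : U.card ≤ Nat.card K := by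
  have := Fintype.ofFinite K
  rw [Nat.card_eq_fintype_card]
  refine Finset.card_le_card_of_injOn (fun P => P.coeff 0) (fun _ _ => Finset.mem_coe.2 (Finset.mem_univ _)) ?_
  intro P hP Q hQ h
  simp only at h
  rw [(hU P hP).1.eq_X_add_C (hU P hP).2.2, (hU Q hQ).1.eq_X_add_C (hU Q hQ).2.2, h]

theorem eq_zero_or_one_of_card_eq_two (hK : Nat.card K = 2) (x : K) : x = 0 ∨ x = 1 := by
  have : Finite K := Nat.finite_of_card_ne_zero (by omega)
  have := Fintype.ofFinite K
  by_contra! hx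
  classical
  have h3 : ({x, 0, 1} : Finset K).card = 3 := by
    rw [Finset.card_eq_three]
    exact ⟨x, 0, 1, hx.1, hx.2, zero_ne_one, rfl⟩
  have := Finset.card_le_univ ({x, 0, 1} : Finset K)
  rw [← Nat.card_eq_fintype_card, hK] at this
  omega

/-- An irreducible quadratic has no root, so it takes the value 1 at both 0 and 1; this leaves only
X^2 + X + 1. -/
theorem card_quadratic_le (hK : Nat.card K = 2) (U : Finset K[X])
    (hU : ∀ P ∈ U, P.Monic ∧ Irreducible P ∧ P.natDegree = 2) : U.card ≤ 1 := by
  rw [Finset.card_le_one]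
  have key : ∀ P ∈ U, P = X ^ 2 + X + 1 := by
    intro P hP
    obtain ⟨hm, hi, hd⟩ := hU P hP
    have hroot : ∀ x, P.eval x = 1 := by
      intro x
      refine (eq_zero_or_one_of_card_eq_two hK (P.eval x)).resolve_left fun h0 => ?_
      have := degree_eq_one_of_irreducible_of_root hi h0
      rw [degree_eq_natDegree hi.ne_zero, hd] at this
      norm_num at this
    have h2 : P = X ^ 2 + C (P.coeff 1) * X + C (P.coeff 0) := by
      conv_lhs => rw [P.as_sum_range_C_mul_X_pow, hd]
      have : P.coeff 2 = 1 := hd ▸ hm.coeff_natDegree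
      simp [Finset.sum_range_succ, this]
      ring
    have h0 : P.coeff 0 = 1 := by rw [coeff_zero_eq_eval_zero, hroot]
    have h1 := hroot 1
    rw [h2, h0] at h1
    simp at h1
    rw [h2, h0]
    rcases eq_zero_or_one_of_card_eq_two hK (P.coeff 1) with h | h
    · exfalso
      rw [h, add_zero] at h1
      have := h1
      simp at this
    · rw [h]; simp
  intro P hP Q hQ
  rw [key P hP, key Q hQ]

/-- The first prime of chain i divides G_i, and the G_i, including G_0, are pairwise coprime. So
first primes and primes of G_0 are distinct and compete for the same supply in each degree. -/
theorem IsDecomposition.card_filter_add_card_filter_le {d n N m : ℕ} {F G : K[X]}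
    {v : Fin n → ExpTuple} {A B : Fin (n + 1) → K[X]} (h : IsDecomposition d F G v A B)
    {T : Finset K[X]} {e : K[X] → ℕ} (hT : IsFactorization (B 0) T e)
    (hN : ∀ U : Finset K[X], (∀ P ∈ U, P.Monic ∧ Irreducible P ∧ P.natDegree = m) → U.card ≤ N) :
    (T.filter fun P => P.natDegree = m).card +
      (Finset.univ.filter fun i => (v i).val 0 = m).card ≤ N := by
  classical
  have hstart : ∀ i, ∃ P : K[X], P.Monic ∧ Irreducible P ∧ P.natDegree = (v i).val 0 ∧
      P ∣ B i.succ := by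
    intro i
    obtain ⟨P, hP, -, hB⟩ := h.mem_chainSet i
    have h1 := hP 1 (by simp)
    refine ⟨P 1, h1.1, h1.2.1, h1.2.2.trans (v i).deg_one, ?_⟩
    simp only at hB
    rw [hB]
    have hmem : 1 ∈ Finset.Icc 1 (v i).len := Finset.mem_Icc.2 ⟨le_rfl, (v i).one_le_len⟩
    exact (dvd_pow_self _ ((v i).val_pos 1 (v i).one_le_len).ne').trans
      (Finset.dvd_prod_of_mem (fun k => P k ^ (v i).val k) hmem)
  choose p hm hi hd hdvd using hstart
  have hinj : Function.Injective p := by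
    intro i j hij
    by_contra hne
    have hc := h.coprime_right i.succ j.succ (fun hs => hne (Fin.succ_injective _ hs))
    exact (hi i).not_isUnit (hc.isUnit_of_dvd' (hdvd i) (hij ▸ hdvd j))
  have hdisj : Disjoint (T.filter fun P => P.natDegree = m)
      ((Finset.univ.filter fun i => (v i).val 0 = m).image p) := by
    rw [Finset.disjoint_left]
    intro P hP hP'
    obtain ⟨i, -, rfl⟩ := Finset.mem_image.1 hP'
    have hc := h.coprime_right 0 i.succ (Fin.succ_ne_zero i).symm
    exact (hi i).not_isUnit (hc.isUnit_of_dvd'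
      (hT.dvd_of_mem (Finset.mem_filter.1 hP).1) (hdvd i))
  rw [← Finset.card_image_of_injective _ hinj, ← Finset.card_union_of_disjoint hdisj]
  refine hN _ fun P hP => ?_
  rcases Finset.mem_union.1 hP with hP | hP
  · obtain ⟨hPT, hPm⟩ := Finset.mem_filter.1 hP
    exact ⟨hT.monic P hPT, hT.irreducible P hPT, hPm⟩
  · obtain ⟨i, hi', rfl⟩ := Finset.mem_image.1 hP
    exact ⟨hm i, hi i, (hd i).trans (Finset.mem_filter.1 hi').2⟩

/-- The pair (F_0, G_0) is arbitrary here, so it may involve degrees and targets not dividing d.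
Those cancel by Zsigmondy, and only the valuations at divisors of d survive. -/
theorem IsDecomposition.exists_prod_eq [Finite K] {d n : ℕ} {F G : K[X]}
    {v : Fin n → ExpTuple} {A B : Fin (n + 1) → K[X]} (h : IsDecomposition d F G v A B)
    (hF : F ≠ 0) (hG : G ≠ 0) (hFG : phi K F = sigma K G)
    (hqd : IsZsigmondyBound (Nat.card K) d) (hd : d ≠ 0) :
    ∃ (S T : Finset K[X]) (f e : K[X] → ℕ),
      IsFactorization (A 0) S f ∧ IsFactorization (B 0) T e ∧
      ∀ r, ∑ n ∈ d.divisors, ((S.filter fun P => P.natDegree = n).card +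
            (T.filter fun P => P.natDegree = n).card +
            (Finset.univ.filter fun i => (v i).val 0 = n).card) *
          (Nat.card K ^ n - 1).factorization r =
        ∑ n ∈ d.divisors, (T.filter fun P => (e P + 1) * P.natDegree = n).card *
          (Nat.card K ^ n - 1).factorization r := by
  have hA0 : A 0 ≠ 0 := fun h0 => hF (h.prod_left ▸ Finset.prod_eq_zero (Finset.mem_univ 0) h0)
  have hB0 : B 0 ≠ 0 := fun h0 => hG (h.prod_right ▸ Finset.prod_eq_zero (Finset.mem_univ 0) h0)
  obtain ⟨S, f, hS⟩ := exists_isFactorization hA0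
  obtain ⟨T, e, hT⟩ := exists_isFactorization hB0
  refine ⟨S, T, f, e, hS, hT, fun r => ?_⟩
  have heq := (h.phi_eq_sigma_iff hB0).1 hFG
  -- The first degrees of the chains play the role of additional primes of F_0.
  have hprod := prod_pow_sub_one_eq (M := Finset.univ.val.map fun i => (v i).val 0) hS hT (by
    rw [← heq, Multiset.map_map]; rfl)
  have := sum_divisors_count_mul_factorization_eq hqd hd ?_ ?_ hprod r
  · simpa only [Multiset.count_add, count_map_val] using this
  · intro a ha
    simp only [Multiset.mem_add, Multiset.mem_map, Finset.mem_val] at ha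
    rcases ha with (⟨P, hP, rfl⟩ | ⟨P, hP, rfl⟩) | ⟨i, -, rfl⟩
    · exact (hS.irreducible P hP).natDegree_pos
    · exact (hT.irreducible P hP).natDegree_pos
    · exact (v i).val_pos 0 (Nat.zero_le _)
  · intro a ha
    simp only [Multiset.mem_map, Finset.mem_val] at ha
    obtain ⟨P, hP, rfl⟩ := ha
    exact Nat.mul_pos (Nat.succ_pos _) (hT.irreducible P hP).natDegree_pos

theorem IsDecomposition.sum_card_filter_eq {d n : ℕ} {F G : K[X]}
    {v : Fin n → ExpTuple} {A B : Fin (n + 1) → K[X]} (h : IsDecomposition d F G v A B)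
    (hd : d ≠ 0) :
    ∑ m ∈ d.divisors, (Finset.univ.filter fun i => (v i).val 0 = m).card = n := by
  rw [← Finset.card_eq_sum_card_fiberwise fun i _ =>
    Finset.mem_coe.2 (Nat.mem_divisors.2 ⟨h.dvd i, hd⟩)]
  simp

theorem degree_of_mul_eq_two {e k : ℕ} (he : 0 < e) (h : (e + 1) * k = 2) : k = 1 := by
  have : k ∣ 2 := ⟨e + 1, by rw [mul_comm, h]⟩
  have := Nat.le_of_dvd (by norm_num) this
  interval_cases k <;> omega

/-- The 2-adic valuations of 3 - 1 and 9 - 1 are 1 and 3. Let c_1, c_2 count the chains starting in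
degree 1, 2, and t the linear primes of G_0. Target 2 comes only from linear primes, so t + c_1 +
3c_2 ≤ 3t; with t + c_1 ≤ 3 this gives 3(c_1 + c_2) ≤ 6. -/
theorem card_le_two_of_isDecomposition (hK : Nat.card K = 3) {n : ℕ} {F G : K[X]}
    {v : Fin n → ExpTuple} {A B : Fin (n + 1) → K[X]} (h : IsDecomposition 2 F G v A B)
    (hF : F ≠ 0) (hG : G ≠ 0) (hFG : phi K F = sigma K G) : n ≤ 2 := by
  have : Finite K := Nat.finite_of_card_ne_zero (by omega)
  obtain ⟨S, T, f, e, hS, hT, heq⟩ := h.exists_prod_eq hF hG hFG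
    (hK ▸ isZsigmondyBound_three) (by norm_num)
  have hsum := h.sum_card_filter_eq (by norm_num)
  have hdiv : (2 : ℕ).divisors = {1, 2} := by decide
  have h2 := heq 2
  have hlin := h.card_filter_add_card_filter_le hT card_linear_le
  have hf1 : (2 : ℕ).factorization 2 = 1 := Nat.prime_two.factorization_self
  have hf2 : (8 : ℕ).factorization 2 = 3 := by
    rw [show (8 : ℕ) = 2 ^ 3 by norm_num, Nat.prime_two.factorization_pow]; simp
  have h0 : (T.filter fun P => (e P + 1) * P.natDegree = 1).card = 0 := by
    rw [Finset.card_eq_zero, Finset.filter_eq_empty_iff]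
    intro P hP h1
    have := hT.pos P hP
    have := Nat.eq_one_of_mul_eq_one_right h1
    omega
  have hle : (T.filter fun P => (e P + 1) * P.natDegree = 2).card ≤
      (T.filter fun P => P.natDegree = 1).card :=
    Finset.card_le_card fun P hP => by
      rw [Finset.mem_filter] at hP ⊢
      exact ⟨hP.1, degree_of_mul_eq_two (hT.pos P hP.1) hP.2⟩
  rw [hdiv, Finset.sum_pair (by norm_num)] at hsum
  rw [hdiv, Finset.sum_pair (by norm_num), Finset.sum_pair (by norm_num), hK] at h2
  simp only [h0] at h2
  norm_num [hf1, hf2] at h2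
  rw [hK] at hlin
  omega

theorem degree_of_mul_eq_six {e k : ℕ} (he : 0 < e) (h : (e + 1) * k = 6) :
    k = 1 ∨ k = 2 ∨ k = 3 := by
  have : k ∣ 6 := ⟨e + 1, by rw [mul_comm, h]⟩
  have := Nat.le_of_dvd (by norm_num) this
  interval_cases k <;> omega

theorem degree_of_mul_eq_three {e k : ℕ} (he : 0 < e) (h : (e + 1) * k = 3) : k = 1 := by
  have : k ∣ 3 := ⟨e + 1, by rw [mul_comm, h]⟩
  have := Nat.le_of_dvd (by norm_num) this
  interval_cases k <;> omega

/-- Among 1, 3, 7, 63 the prime 7 divides only 7 and 63, once each. So the chains starting in degree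
3 or 6, together with the cubic primes of G_0, number at most the primes of G_0 with target 3 or 6.
Removing cubic primes, the chains starting in degree 3 or 6 are bounded by linear and quadratic
primes of G_0. These and the first primes of the other chains share two linear primes and one
quadratic prime, whence n ≤ 3. The other two restrictions are that supply itself. -/
theorem bounds_of_isDecomposition_of_card_eq_two (hK : Nat.card K = 2) {n : ℕ} {F G : K[X]}
    {v : Fin n → ExpTuple} {A B : Fin (n + 1) → K[X]} (h : IsDecomposition 6 F G v A B)
    (hF : F ≠ 0) (hG : G ≠ 0) (hFG : phi K F = sigma K G) :
    n ≤ 3 ∧ (∀ i j, i ≠ j → ¬ ((v i).val 0 = 2 ∧ (v j).val 0 = 2)) ∧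
      ¬ (n = 3 ∧ ∀ i, (v i).val 0 = 1) := by
  classical
  have : Finite K := Nat.finite_of_card_ne_zero (by omega)
  obtain ⟨S, T, f, e, hS, hT, heq⟩ := h.exists_prod_eq hF hG hFG
    (hK ▸ isZsigmondyBound_two) (by norm_num)
  have hsum := h.sum_card_filter_eq (by norm_num)
  have hdiv : (6 : ℕ).divisors = {1, 2, 3, 6} := by decide
  have hlin := h.card_filter_add_card_filter_le hT card_linear_le
  have hquad := h.card_filter_add_card_filter_le hT (card_quadratic_le hK)
  rw [hK] at hlin
  refine ⟨?_, ?_, ?_⟩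
  · have e3 := heq 3
    have e7 := heq 7
    have hf3 : (3 : ℕ).factorization 3 = 1 := Nat.prime_three.factorization_self
    have hf7 : (7 : ℕ).factorization 7 = 1 := (by norm_num : Nat.Prime 7).factorization_self
    have hf73 : (7 : ℕ).factorization 3 = 0 := Nat.factorization_eq_zero_of_not_dvd (by norm_num)
    have hf37 : (3 : ℕ).factorization 7 = 0 := Nat.factorization_eq_zero_of_not_dvd (by norm_num)
    have h63 : (63 : ℕ) = 3 ^ 2 * 7 := by norm_num
    have hf633 : (63 : ℕ).factorization 3 = 2 := by
      rw [h63, Nat.factorization_mul (by norm_num) (by norm_num), Nat.factorization_pow]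
      simp [hf3, hf73]
    have hf637 : (63 : ℕ).factorization 7 = 1 := by
      rw [h63, Nat.factorization_mul (by norm_num) (by norm_num), Nat.factorization_pow]
      simp [hf7, hf37]
    have hsum4 : ∀ g : ℕ → ℕ, ∑ n ∈ ({1, 2, 3, 6} : Finset ℕ), g n = g 1 + g 2 + g 3 + g 6 := by
      intro g
      simp [add_assoc]
    rw [hdiv, hsum4] at hsum
    rw [hdiv, hsum4, hsum4, hK] at e3 e7
    norm_num [hf3, hf7, hf73, hf37, hf633, hf637] at e3 e7
    -- Primes of G_0 of degree j and target t. One prime has one target, so the sets for a fixed j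
    -- are disjoint.
    set c : ℕ → ℕ → Finset K[X] := fun j t =>
      T.filter fun P => P.natDegree = j ∧ (e P + 1) * P.natDegree = t with hc
    have hle : ∀ t j, (∀ P ∈ T, (e P + 1) * P.natDegree = t → P.natDegree = j) →
        (T.filter fun P => (e P + 1) * P.natDegree = t).card ≤ (c j t).card := by
      intro t j htj
      refine Finset.card_le_card fun P hP => ?_
      simp only [Finset.mem_filter, hc] at hP ⊢
      exact ⟨hP.1, htj P hP.1 hP.2, hP.2⟩
    have h2 := hle 2 1 fun P hP h => degree_of_mul_eq_two (hT.pos P hP) h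
    have h3 := hle 3 1 fun P hP h => degree_of_mul_eq_three (hT.pos P hP) h
    have h6 : (T.filter fun P => (e P + 1) * P.natDegree = 6).card ≤
        (c 1 6).card + (c 2 6).card + (c 3 6).card := by
      refine le_trans (Finset.card_le_card (t := c 1 6 ∪ c 2 6 ∪ c 3 6) fun P hP => ?_)
        ((Finset.card_union_le _ _).trans (Nat.add_le_add_right (Finset.card_union_le _ _) _))
      simp only [Finset.mem_filter, Finset.mem_union, hc] at hP ⊢
      have := degree_of_mul_eq_six (hT.pos P hP.1) hP.2
      tauto
    have hg : ∀ j t, (c j t).card ≤ (T.filter fun P => P.natDegree = j).card := fun j t =>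
      Finset.card_le_card fun P hP => by
        simp only [Finset.mem_filter, hc] at hP ⊢
        exact ⟨hP.1, hP.2.1⟩
    have hdisj : ∀ j s t, s ≠ t → Disjoint (c j s) (c j t) := by
      intro j s t hst
      rw [Finset.disjoint_left]
      intro P hP hP'
      simp only [Finset.mem_filter, hc] at hP hP'
      exact hst (hP.2.2.symm.trans hP'.2.2)
    have hg1 : (c 1 2).card + (c 1 3).card + (c 1 6).card ≤
        (T.filter fun P => P.natDegree = 1).card := by
      rw [← Finset.card_union_of_disjoint (hdisj 1 2 3 (by norm_num)),
        ← Finset.card_union_of_disjoint (Finset.disjoint_union_left.2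
          ⟨hdisj 1 2 6 (by norm_num), hdisj 1 3 6 (by norm_num)⟩)]
      refine Finset.card_le_card fun P hP => ?_
      simp only [Finset.mem_filter, Finset.mem_union, hc] at hP ⊢
      tauto
    have hg2 := hg 2 6
    have hg3 := hg 3 6
    omega
  · rintro i j hij ⟨hi, hj⟩
    have : 1 < (Finset.univ.filter fun i => (v i).val 0 = 2).card :=
      Finset.one_lt_card.2 ⟨i, by simp [hi], j, by simp [hj], hij⟩
    omega
  · rintro ⟨rfl, hall⟩
    have : (Finset.univ.filter fun i => (v i).val 0 = 1).card = 3 := by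
      rw [Finset.filter_true_of_mem fun i _ => hall i]
      simp
    omega

end Bounds
end PhiSigma

namespace PhiSigma

/-! ### The combinatorics of chains -/

section AbstractChains

theorem exists_equiv_of_card_fiber_eq {α β γ : Type*} [Fintype α] [Fintype β] [DecidableEq γ]
    (f : α → γ) (g : β → γ)
    (h : ∀ c, Fintype.card {x // f x = c} = Fintype.card {y // g y = c}) :
    ∃ E : α ≃ β, ∀ x, g (E x) = f x := by
  have e : ∀ c, {x // f x = c} ≃ {y // g y = c} := fun c => Classical.choice
    (Fintype.card_eq.1 (h c))
  refine ⟨(Equiv.sigmaFiberEquiv f).symm.trans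
    ((Equiv.sigmaCongrRight e).trans (Equiv.sigmaFiberEquiv g)), fun x => ?_⟩
  exact (e (f x) ⟨x, rfl⟩).2

/-- If, away from the divisors of `d`, the degrees of two kinds of objects are matched by the targets
`t` of the second kind, then the objects of the second kind whose target does not divide `d` are
arranged in chains, each ending in an object of the first kind. -/
theorem exists_chains {α β : Type*} [Fintype α] [Fintype β] (a : α → ℕ) (b t : β → ℕ) (d : ℕ)
    (hlt : ∀ y, b y < t y) (hdvd : ∀ y, b y ∣ t y)
    (hcount : ∀ n, ¬ n ∣ d → Fintype.card {x // a x = n} + Fintype.card {y // b y = n} =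
      Fintype.card {y // t y = n}) :
    ∃ (n : ℕ) (m : Fin n → ℕ) (y : Fin n → ℕ → β) (x : Fin n → α),
      (∀ i, b (y i 0) ∣ d ∧ ¬ t (y i 0) ∣ d) ∧
      (∀ i, ∀ k < m i, b (y i (k + 1)) = t (y i k)) ∧
      (∀ i, a (x i) = t (y i (m i))) ∧
      Function.Injective x ∧
      (∀ x', ¬ a x' ∣ d ↔ ∃ i, x i = x') ∧
      (∀ i k i' k', k ≤ m i → k' ≤ m i' → y i k = y i' k' → i = i' ∧ k = k') ∧
      (∀ y', ¬ t y' ∣ d ↔ ∃ i k, k ≤ m i ∧ y i k = y') := by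
  classical
  let deg : α ⊕ β → ℕ := Sum.elim a b
  -- Equal counts in each fibre give a degree-preserving matching; its inverse will be the successor
  -- map.
  obtain ⟨E, hE⟩ : ∃ E : {w : α ⊕ β // ¬ deg w ∣ d} ≃ {y : β // ¬ t y ∣ d},
      ∀ w, t (E w).1 = deg w.1 := by
    refine exists_equiv_of_card_fiber_eq (fun w : {w : α ⊕ β // ¬ deg w ∣ d} => deg w.1)
      (fun y : {y : β // ¬ t y ∣ d} => t y.1) fun c => ?_
    by_cases hc : c ∣ d
    · rw [Fintype.card_eq_zero_iff.2 ⟨fun w => w.1.2 (by rwa [w.2])⟩,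
        Fintype.card_eq_zero_iff.2 ⟨fun w => w.1.2 (by rwa [w.2])⟩]
    · have e1 : {w : {w : α ⊕ β // ¬ deg w ∣ d} // deg w.1 = c} ≃ {w : α ⊕ β // deg w = c} :=
        Equiv.subtypeSubtypeEquivSubtype fun {w} (hw : deg w = c) => by rwa [hw]
      have e2 : {y : {y : β // ¬ t y ∣ d} // t y.1 = c} ≃ {y : β // t y = c} :=
        Equiv.subtypeSubtypeEquivSubtype fun {w} (hw : t w = c) => by rwa [hw]
      have e3 : {w : α ⊕ β // deg w = c} ≃ {x // a x = c} ⊕ {y // b y = c} :=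
        Equiv.subtypeSum
      rw [Fintype.card_congr e1, Fintype.card_congr e2, Fintype.card_congr e3, Fintype.card_sum,
        hcount c hc]
  -- The fixed points are only fillers: an orbit from a start never meets an element of β whose
  -- target divides d (`htgt`), and it is cut at its first element of α.
  let step : α ⊕ β → α ⊕ β := Sum.elim Sum.inl fun y =>
    if h : ¬ t y ∣ d then (E.symm ⟨y, h⟩).1 else Sum.inr y
  have hstep : ∀ y (h : ¬ t y ∣ d), step (Sum.inr y) = (E.symm ⟨y, h⟩).1 := fun y h => dif_pos h
  have hdeg : ∀ y, ¬ t y ∣ d → deg (step (Sum.inr y)) = t y := by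
    intro y h
    rw [hstep y h, ← hE, Equiv.apply_symm_apply]
  have hstep_inj : ∀ y y', ¬ t y ∣ d → ¬ t y' ∣ d → step (Sum.inr y) = step (Sum.inr y') →
      y = y' := by
    intro y y' h h' heq
    rw [hstep y h, hstep y' h'] at heq
    exact congrArg Subtype.val (E.symm.injective (Subtype.ext heq))
  have hstep_surj : ∀ w, ¬ deg w ∣ d → ∃ y, ¬ t y ∣ d ∧ step (Sum.inr y) = w := by
    intro w hw
    refine ⟨(E ⟨w, hw⟩).1, (E ⟨w, hw⟩).2, ?_⟩
    rw [hstep _ (E ⟨w, hw⟩).2, Subtype.coe_eta, Equiv.symm_apply_apply]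
  let Start := {y : β // b y ∣ d ∧ ¬ t y ∣ d}
  let z : Start → ℕ → α ⊕ β := fun s k => step^[k] (Sum.inr s.1)
  have hz0 : ∀ s, z s 0 = Sum.inr s.1 := fun s => rfl
  have hzs : ∀ s k, z s (k + 1) = step (z s k) := fun s k => Function.iterate_succ_apply' _ _ _
  have htgt : ∀ s k y, z s k = Sum.inr y → ¬ t y ∣ d := by
    intro s k
    induction k with
    | zero =>
      intro y hy
      rw [hz0] at hy
      exact Sum.inr_injective hy ▸ s.2.2
    | succ k ih =>
      intro y hy
      rw [hzs] at hy
      rcases hk : z s k with x0 | y0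
      · rw [hk] at hy
        exact absurd hy Sum.inl_ne_inr
      · rw [hk] at hy
        have h1 := hdeg y0 (ih y0 hk)
        rw [hy] at h1
        intro h2
        exact ih y0 hk (h1 ▸ (hdvd y).trans h2)
  -- Degrees increase strictly as long as the orbit stays in the finite set β, so it must leave β.
  have hterm : ∀ s, ∃ k, (z s k).isLeft = true := by
    intro s
    by_contra! hno
    have hr : ∀ k, ∃ y, z s k = Sum.inr y := fun k => by
      rcases hk : z s k with x0 | y0
      · exact absurd (by rw [hk]; rfl) (hno k)
      · exact ⟨y0, rfl⟩
    choose y hy using hr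
    have hge : ∀ k, k ≤ b (y k) := by
      intro k
      induction k with
      | zero => exact Nat.zero_le _
      | succ k ih =>
        have h1 := hdeg (y k) (htgt s k _ (hy k))
        rw [← hy k, ← hzs, hy (k + 1)] at h1
        have h2 := hlt (y k)
        change b (y (k + 1)) = _ at h1
        omega
    have h1 := hge (Finset.univ.sup b + 1)
    have h2 : b (y (Finset.univ.sup b + 1)) ≤ Finset.univ.sup b :=
      Finset.le_sup (f := b) (Finset.mem_univ _)
    omega
  let M : Start → ℕ := fun s => Nat.find (hterm s)
  have hM : ∀ s, (z s (M s)).isLeft = true := fun s => Nat.find_spec (hterm s)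
  have hlt_M : ∀ s k, k < M s → ∃ y, z s k = Sum.inr y := by
    intro s k hk
    rcases hk' : z s k with x0 | y0
    · exact absurd (by rw [hk']; rfl) (Nat.find_min (hterm s) hk)
    · exact ⟨y0, rfl⟩
  have hMpos : ∀ s, 0 < M s := fun s => Nat.pos_of_ne_zero fun h0 => by
    have := hM s
    rw [h0, hz0] at this
    exact Bool.false_ne_true this
  have hdegz : ∀ s k y, z s k = Sum.inr y → deg (z s (k + 1)) = t y := by
    intro s k y hy
    rw [hzs, hy]
    exact hdeg y (htgt s k y hy)
  -- Trace both orbits back by injectivity of the matching. A start cannot be a successor, since its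
  -- degree divides d and that of a successor does not.
  have hinj : ∀ s k s' k', k ≤ M s → k' ≤ M s' → z s k = z s' k' → s = s' ∧ k = k' := by
    have hne : ∀ s s' k, k < M s' → z s 0 ≠ z s' (k + 1) := by
      intro s s' k hk heq
      obtain ⟨y, hy⟩ := hlt_M s' k hk
      have h1 := hdegz s' k y hy
      rw [← heq, hz0] at h1
      exact htgt s' k y hy (h1 ▸ s.2.1)
    intro s k
    induction k with
    | zero =>
      intro s' k' _ hk' heq
      cases k' with
      | zero => exact ⟨Subtype.ext (Sum.inr_injective heq), rfl⟩
      | succ k' => exact absurd heq (hne s s' k' hk')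
    | succ k ih =>
      intro s' k' hk hk' heq
      cases k' with
      | zero => exact absurd heq.symm (hne s' s k hk)
      | succ k' =>
        obtain ⟨y, hy⟩ := hlt_M s k hk
        obtain ⟨y', hy'⟩ := hlt_M s' k' hk'
        rw [hzs, hzs, hy, hy'] at heq
        have := hstep_inj y y' (htgt _ _ _ hy) (htgt _ _ _ hy') heq
        obtain ⟨h1, h2⟩ := ih s' k' (by omega) (by omega) (by rw [hy, hy', this])
        exact ⟨h1, by rw [h2]⟩
  -- Strong induction on the degree: an element whose degree does not divide d has a predecessor, of
  -- smaller degree; otherwise it is a start.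
  have hsurj : ∀ N w, deg w = N → (¬ deg w ∣ d ∨ ∃ y, w = Sum.inr y ∧ ¬ t y ∣ d) →
      ∃ s k, k ≤ M s ∧ z s k = w := by
    intro N
    induction N using Nat.strong_induction_on with
    | _ N ih =>
      intro w hw hcase
      by_cases hwd : deg w ∣ d
      · obtain ⟨y, rfl, hy⟩ := hcase.resolve_left (not_not.2 hwd)
        exact ⟨⟨y, hwd, hy⟩, 0, Nat.zero_le _, rfl⟩
      · obtain ⟨y, hy, hyw⟩ := hstep_surj w hwd
        have hty : t y = deg w := by rw [← hyw, hdeg y hy]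
        obtain ⟨s, k, hk, hzk⟩ := ih (b y) (by have := hlt y; omega) (Sum.inr y) rfl
          (Or.inr ⟨y, rfl, hy⟩)
        have hkM : k ≠ M s := by
          rintro rfl
          have := hM s
          rw [hzk] at this
          exact Bool.false_ne_true this
        exact ⟨s, k + 1, by omega, by rw [hzs, hzk, hyw]⟩
  let ι : Fin (Fintype.card Start) ≃ Start := (Fintype.equivFin Start).symm
  -- At indices where the orbit is in α, the start serves as a filler value.
  let y : Fin (Fintype.card Start) → ℕ → β := fun i k => Sum.elim (fun _ => (ι i).1) id (z (ι i) k)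
  have hy : ∀ i k, k < M (ι i) → z (ι i) k = Sum.inr (y i k) := by
    intro i k hk
    obtain ⟨y0, hy0⟩ := hlt_M (ι i) k hk
    simp only [y, hy0, Sum.elim_inr, id]
  have hx : ∀ i, ∃ x, z (ι i) (M (ι i)) = Sum.inl x := fun i => Sum.isLeft_iff.1 (hM (ι i))
  choose x hx using hx
  -- Index M is the terminal object in α, so the last object in β has index M - 1; M is positive
  -- because a start lies in β.
  refine ⟨Fintype.card Start, fun i => M (ι i) - 1, y, x, ?_, ?_, ?_, ?_, ?_, ?_, ?_⟩
  · intro i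
    exact (ι i).2
  · intro i k hk
    beta_reduce at hk
    have h1 := hdegz _ _ _ (hy i k (by omega))
    rwa [hy i (k + 1) (by omega)] at h1
  · intro i
    have hp := hMpos (ι i)
    have h1 := hdegz _ _ _ (hy i (M (ι i) - 1) (by omega))
    rwa [Nat.sub_add_cancel hp, hx i] at h1
  · intro i j hij
    have := (hinj (ι i) _ (ι j) _ le_rfl le_rfl (by rw [hx, hx, hij])).1
    exact ι.injective this
  · intro x'
    constructor
    · intro hx'
      obtain ⟨s, k, hk, hzk⟩ := hsurj _ (Sum.inl x') rfl (Or.inl hx')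
      have hkM : k = M s := by
        by_contra hne
        obtain ⟨y0, hy0⟩ := hlt_M s k (by omega)
        rw [hzk] at hy0
        exact Sum.inl_ne_inr hy0
      obtain ⟨i, rfl⟩ := ι.surjective s
      refine ⟨i, Sum.inl_injective (β := β) ?_⟩
      rw [← hx, ← hzk, hkM]
    · rintro ⟨i, rfl⟩
      have hp := hMpos (ι i)
      have h0 := hy i (M (ι i) - 1) (by omega)
      have h1 := hdegz _ _ _ h0
      rw [Nat.sub_add_cancel hp, hx i] at h1
      change a (x i) = _ at h1
      rw [h1]
      exact htgt _ _ _ h0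
  · intro i k i' k' hk hk' heq
    beta_reduce at hk hk'
    have hp := hMpos (ι i)
    have hp' := hMpos (ι i')
    obtain ⟨h1, h2⟩ := hinj (ι i) k (ι i') k' (by omega) (by omega)
      (by rw [hy i k (by omega), hy i' k' (by omega), heq])
    exact ⟨ι.injective h1, h2⟩
  · intro y'
    constructor
    · intro hy'
      obtain ⟨s, k, hk, hzk⟩ := hsurj _ (Sum.inr y') rfl (Or.inr ⟨y', rfl, hy'⟩)
      have hkM : k ≠ M s := by
        rintro rfl
        have := hM s
        rw [hzk] at this
        exact Bool.false_ne_true this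
      obtain ⟨i, rfl⟩ := ι.surjective s
      refine ⟨i, k, ?_, Sum.inr_injective (α := α) (by rw [← hy i k (by omega), hzk])⟩
      beta_reduce
      omega
    · rintro ⟨i, k, hk, rfl⟩
      beta_reduce at hk
      have hp := hMpos (ι i)
      exact htgt _ _ _ (hy i k (by omega))

end AbstractChains

/-! ### Every solution has a decomposition -/

section Decompositions

open Polynomial

variable {K : Type*} [Field K]

theorem IsFactorization.natDegree_eq {G : K[X]} {S : Finset K[X]} {e : K[X] → ℕ}
    (h : IsFactorization G S e) : G.natDegree = ∑ P ∈ S, e P * P.natDegree := by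
  obtain ⟨c, hc, hG⟩ := h.eq_prod
  rw [hG, natDegree_C_mul hc, natDegree_prod_of_monic _ _ fun P hP => (h.monic P hP).pow _]
  exact Finset.sum_congr rfl fun P _ => natDegree_pow _ _

theorem IsFactorization.eq_one_of_squarefree {G : K[X]} {S : Finset K[X]} {e : K[X] → ℕ}
    (h : IsFactorization G S e) (hG : Squarefree G) : ∀ P ∈ S, e P = 1 := by
  intro P hP
  by_contra hne
  have h2 : 2 ≤ e P := by have := h.pos P hP; omega
  refine (h.irreducible P hP).not_isUnit (hG P ?_)
  rw [← pow_two]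
  exact (pow_dvd_pow P h2).trans (h.pow_dvd hP)

theorem IsFactorization.squarefree {G : K[X]} {S : Finset K[X]} {e : K[X] → ℕ}
    (h : IsFactorization G S e) (he : ∀ P ∈ S, e P = 1) : Squarefree G := by
  rw [squarefree_iff_irreducible_sq_not_dvd_of_ne_zero h.ne_zero]
  intro P hP hd
  obtain ⟨Q, hQ, hPQ⟩ := h.exists_associated_of_dvd hP ((dvd_mul_right P P).trans hd)
  refine h.not_pow_succ_dvd hQ ?_
  rw [he Q hQ, pow_two]
  exact ((hPQ.mul_mul hPQ).symm.dvd).trans hd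

/-- Only finitely many primes have degree at most d, and each contributes at most d to the degree of
either polynomial; hence both degrees are bounded. -/
theorem finite_exceptionalSet [Finite K] {d : ℕ} (hd : d ≠ 0) : (exceptionalSet K d).Finite := by
  classical
  have hL := finite_setOf_natDegree_le (K := K) d
  set N := hL.toFinset.card * d with hN
  have key : ∀ {G : K[X]} {S : Finset K[X]} {e : K[X] → ℕ}, IsFactorization G S e →
      (∀ P ∈ S, P.natDegree ≤ d ∧ e P * P.natDegree ≤ d) → G.natDegree ≤ N := by
    intro G S e h hle
    rw [h.natDegree_eq]
    refine (Finset.sum_le_card_nsmul _ _ d fun P hP => (hle P hP).2).trans ?_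
    rw [smul_eq_mul, hN]
    refine Nat.mul_le_mul_right d (Finset.card_le_card fun P hP => ?_)
    rw [Set.Finite.mem_toFinset]
    exact (hle P hP).1
  refine ((finite_setOf_natDegree_le (K := K) N).prod (finite_setOf_natDegree_le N)).subset ?_
  rintro ⟨F, G⟩ ⟨hsq, hF, hG0, hG⟩
  simp only at hsq hF hG0 hG
  obtain ⟨S, f, hS⟩ := exists_isFactorization hsq.ne_zero
  obtain ⟨T, e, hT⟩ := exists_isFactorization hG0
  refine ⟨key hS fun P hP => ?_, key hT fun P hP => ?_⟩
  · have h1 := Nat.le_of_dvd (Nat.pos_of_ne_zero hd) (hF P (hS.irreducible P hP) (hS.dvd_of_mem hP))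
    rw [hS.eq_one_of_squarefree hsq P hP, one_mul]
    exact ⟨h1, h1⟩
  · have h1 := Nat.le_of_dvd (Nat.pos_of_ne_zero hd) (hG P (e P) (hT.irreducible P hP)
      (hT.pos P hP) (hT.pow_dvd hP) (hT.not_pow_succ_dvd hP))
    rw [add_mul, one_mul] at h1
    omega

theorem IsFactorization.mem_exceptionalSet {d : ℕ} {F G : K[X]} {S T : Finset K[X]}
    {f e : K[X] → ℕ} (hS : IsFactorization F S f) (hT : IsFactorization G T e)
    (hf : ∀ P ∈ S, f P = 1 ∧ P.natDegree ∣ d) (he : ∀ P ∈ T, (e P + 1) * P.natDegree ∣ d) :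
    (F, G) ∈ exceptionalSet K d := by
  refine ⟨hS.squarefree fun P hP => (hf P hP).1, ?_, hT.ne_zero, ?_⟩
  · intro P hP hd
    obtain ⟨Q, hQ, hPQ⟩ := hS.exists_associated_of_dvd hP hd
    rw [natDegree_eq_of_degree_eq (degree_eq_degree_of_associated hPQ)]
    exact (hf Q hQ).2
  · intro P k hP hk hd hnd
    simp only at hd hnd
    obtain ⟨Q, hQ, hPQ⟩ := hT.exists_associated_of_dvd hP ((dvd_pow_self P hk.ne').trans hd)
    rw [natDegree_eq_of_degree_eq (degree_eq_degree_of_associated hPQ)]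
    rw [(hPQ.pow_pow (n := k)).dvd_iff_dvd_left] at hd
    rw [(hPQ.pow_pow (n := k + 1)).dvd_iff_dvd_left] at hnd
    have h1 : k ≤ e Q := by
      by_contra hlt
      exact hT.not_pow_succ_dvd hQ ((pow_dvd_pow Q (by omega)).trans hd)
    have h2 : e Q ≤ k := by
      by_contra hlt
      exact hnd ((pow_dvd_pow Q (by omega)).trans (hT.pow_dvd hQ))
    rw [le_antisymm h1 h2]
    exact he Q hQ

theorem card_subtype_mem_eq {α : Type*} (S : Finset α) (f : α → ℕ) (n : ℕ) :
    Fintype.card {x : {x // x ∈ S} // f x.1 = n} = (S.filter fun x => f x = n).card := by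
  rw [← Fintype.card_coe]
  refine Fintype.card_congr ((Equiv.subtypeSubtypeEquivSubtypeInter (· ∈ S) (f · = n)).trans
    (Equiv.subtypeEquivRight fun x => ?_))
  rw [Finset.mem_filter]

/-- `exists_chains` is applied to the primes of F and of G. A prime of F goes to F_0 when its degree
divides d, a prime of G goes to G_0 when its target divides d; the chains account for exactly the
others. -/
theorem hasDecompositions [Finite K] {d : ℕ} (hd : d ≠ 0)
    (hqd : IsZsigmondyBound (Nat.card K) d) : HasDecompositions K d := by
  classical
  refine ⟨finite_exceptionalSet hd, fun F G hF hG hFG => ?_⟩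
  obtain ⟨S, f, hS⟩ := exists_isFactorization hF
  obtain ⟨T, e, hT⟩ := exists_isFactorization hG
  have hf := exponent_eq_one_of_phi_mul_eq_sigma (N := 1) hS hG (by rw [mul_one, hFG])
  have hprod := prod_pow_sub_one_eq (M := 0) hS hT (by simpa using hFG)
  have hcount : ∀ n, ¬ n ∣ d → (S.filter fun P => P.natDegree = n).card +
      (T.filter fun P => P.natDegree = n).card =
        (T.filter fun P => (e P + 1) * P.natDegree = n).card := by
    intro n hn
    have := count_eq_of_prod_eq hqd ?_ ?_ hprod hn
    · simpa only [Multiset.count_add, count_map_val, Multiset.count_zero, add_zero] using this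
    · intro a ha
      simp only [Multiset.mem_add, Multiset.mem_map, Finset.mem_val, Multiset.notMem_zero,
        or_false] at ha
      rcases ha with ⟨P, hP, rfl⟩ | ⟨P, hP, rfl⟩
      · exact (hS.irreducible P hP).natDegree_pos
      · exact (hT.irreducible P hP).natDegree_pos
    · intro a ha
      simp only [Multiset.mem_map, Finset.mem_val] at ha
      obtain ⟨P, hP, rfl⟩ := ha
      exact Nat.mul_pos (Nat.succ_pos _) (hT.irreducible P hP).natDegree_pos
  obtain ⟨n, m, y, x, hstart, hnext, hlast, hxinj, hxran, hyinj, hyran⟩ :=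
    exists_chains (fun P : {P // P ∈ S} => P.1.natDegree) (fun P : {P // P ∈ T} => P.1.natDegree)
      (fun P : {P // P ∈ T} => (e P.1 + 1) * P.1.natDegree) d
      (fun P => by
        have h1 := (hT.irreducible P.1 P.2).natDegree_pos
        have h2 := hT.pos P.1 P.2
        nlinarith)
      (fun P => dvd_mul_left _ _)
      (fun n hn => by
        rw [card_subtype_mem_eq S natDegree, card_subtype_mem_eq T natDegree,
          card_subtype_mem_eq T fun P => (e P + 1) * P.natDegree]
        exact hcount n hn)
  -- Chains from `exists_chains` are indexed from 0, those of the statement from 1, hence the shift.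
  -- Index m i is the last prime of G, so the length is m i + 1.
  let v : Fin n → ExpTuple := fun i =>
    { len := m i + 1
      val := fun k => if k = 0 then (y i 0).1.natDegree else e (y i (k - 1)).1
      one_le_len := by omega
      val_pos := by
        intro k _
        split_ifs
        · exact (hT.irreducible _ (y i 0).2).natDegree_pos
        · exact hT.pos _ (y i (k - 1)).2 }
  have hv0 : ∀ i, (v i).val 0 = (y i 0).1.natDegree := fun i => rfl
  have hvs : ∀ i k, (v i).val (k + 1) = e (y i k).1 := fun i k => rfl
  have hvdeg : ∀ i, ∀ k ≤ m i, (v i).deg (k + 1) = (y i k).1.natDegree := by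
    intro i k hk
    induction k with
    | zero => rw [zero_add, ExpTuple.deg_one, hv0]
    | succ k ih =>
      rw [ExpTuple.deg_succ _ (by omega), ih (by omega), hvs, hnext i k (by omega)]
  have hvlast : ∀ i, (v i).deg (m i + 1 + 1) = (x i).1.natDegree := by
    intro i
    rw [ExpTuple.deg_succ _ (by omega), hvdeg i _ le_rfl, hvs, hlast i]
  obtain ⟨c, hc, hFc⟩ := hS.eq_prod
  obtain ⟨c', hc', hGc⟩ := hT.eq_prod
  set S0 := S.filter fun P => P.natDegree ∣ d with hS0
  set T0 := T.filter fun P => (e P + 1) * P.natDegree ∣ d with hT0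
  have hS0S : S0 ⊆ S := Finset.filter_subset _ _
  have hT0T : T0 ⊆ T := Finset.filter_subset _ _
  have hSF : IsFactorization (C c * ∏ P ∈ S0, P ^ f P) S0 f :=
    ⟨fun P hP => hS.monic P (hS0S hP), fun P hP => hS.irreducible P (hS0S hP),
      fun P hP => hS.pos P (hS0S hP), c, hc, rfl⟩
  have hTF : IsFactorization (C c' * ∏ P ∈ T0, P ^ e P) T0 e :=
    ⟨fun P hP => hT.monic P (hT0T hP), fun P hP => hT.irreducible P (hT0T hP),
      fun P hP => hT.pos P (hT0T hP), c', hc', rfl⟩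
  have hxnot : ∀ i, (x i).1 ∉ S0 := fun i hi => (hxran (x i)).2 ⟨i, rfl⟩ (Finset.mem_filter.1 hi).2
  have hynot : ∀ i, ∀ k ≤ m i, (y i k).1 ∉ T0 := fun i k hk hi =>
    (hyran (y i k)).2 ⟨i, k, hk, rfl⟩ (Finset.mem_filter.1 hi).2
  -- Chains consist of monic primes, so the leading constants of F and G are absorbed into F_0 and
  -- G_0.
  let A : Fin (n + 1) → K[X] := Fin.cons (C c * ∏ P ∈ S0, P ^ f P) fun i => (x i).1
  let B : Fin (n + 1) → K[X] := Fin.cons (C c' * ∏ P ∈ T0, P ^ e P) fun i =>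
    ∏ k ∈ Finset.range (m i + 1), (y i k).1 ^ e (y i k).1
  have hA0 : A 0 = C c * ∏ P ∈ S0, P ^ f P := rfl
  have hAs : ∀ i : Fin n, A i.succ = (x i).1 := fun i => rfl
  have hB0 : B 0 = C c' * ∏ P ∈ T0, P ^ e P := rfl
  have hBs : ∀ i : Fin n, B i.succ = ∏ k ∈ Finset.range (m i + 1), (y i k).1 ^ e (y i k).1 :=
    fun i => rfl
  have hcopA : ∀ j : Fin n, IsCoprime (A 0) (A j.succ) := by
    intro j
    rw [hA0, hAs, isCoprime_mul_unit_left_left (isUnit_C.2 (isUnit_iff_ne_zero.2 hc))]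
    exact IsCoprime.prod_left fun P hP => (hS.isCoprime (hS0S hP) (x j).2
      (by rintro rfl; exact hxnot j hP)).pow_left
  have hcopB : ∀ j : Fin n, IsCoprime (B 0) (B j.succ) := by
    intro j
    rw [hB0, hBs, isCoprime_mul_unit_left_left (isUnit_C.2 (isUnit_iff_ne_zero.2 hc'))]
    exact IsCoprime.prod_left fun P hP => IsCoprime.prod_right fun k hk =>
      (hT.isCoprime (hT0T hP) (y j k).2 (by
        rintro rfl
        exact hynot j k (by rw [Finset.mem_range] at hk; omega) hP)).pow
  refine ⟨n, v, A, B, ⟨?_, ?_, ?_, ?_, ?_, ?_⟩, ?_, ?_⟩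
  · rw [Fin.prod_univ_succ, hA0, hFc, mul_assoc, hS0]
    congr 1
    rw [← Finset.prod_filter_mul_prod_filter_not S fun P => P.natDegree ∣ d]
    congr 1
    have : (S.filter fun P => ¬ P.natDegree ∣ d) = Finset.univ.image fun i => (x i).1 := by
      ext P
      simp only [Finset.mem_filter, Finset.mem_image, Finset.mem_univ, true_and]
      constructor
      · rintro ⟨hP, hPd⟩
        obtain ⟨i, hi⟩ := (hxran ⟨P, hP⟩).1 hPd
        exact ⟨i, by rw [hi]⟩
      · rintro ⟨i, rfl⟩
        exact ⟨(x i).2, (hxran (x i)).2 ⟨i, rfl⟩⟩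
    rw [this, Finset.prod_image fun i _ j _ hij => hxinj (Subtype.ext hij)]
    exact Finset.prod_congr rfl fun i _ => by rw [hf _ (x i).2, pow_one, hAs]
  · rw [Fin.prod_univ_succ, hB0, hGc, mul_assoc, hT0]
    congr 1
    rw [← Finset.prod_filter_mul_prod_filter_not T fun P => (e P + 1) * P.natDegree ∣ d]
    congr 1
    have : (T.filter fun P => ¬ (e P + 1) * P.natDegree ∣ d) =
        (Finset.univ.sigma fun i => Finset.range (m i + 1)).image
          fun p : (_ : Fin n) × ℕ => (y p.1 p.2).1 := by
      ext P
      simp only [Finset.mem_filter, Finset.mem_image, Finset.mem_sigma, Finset.mem_univ, true_and,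
        Finset.mem_range]
      constructor
      · rintro ⟨hP, hPd⟩
        obtain ⟨i, k, hk, hi⟩ := (hyran ⟨P, hP⟩).1 hPd
        exact ⟨⟨i, k⟩, Nat.lt_succ_of_le hk, by rw [hi]⟩
      · rintro ⟨⟨i, k⟩, hk, rfl⟩
        exact ⟨(y i k).2, (hyran (y i k)).2 ⟨i, k, Nat.le_of_lt_succ hk, rfl⟩⟩
    rw [this, Finset.prod_image, Finset.prod_sigma]
    · exact Finset.prod_congr rfl fun i _ => by rw [hBs]
    · rintro ⟨i, k⟩ hi ⟨j, l⟩ hj hij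
      simp only [Finset.coe_sigma, Set.mem_sigma_iff, Finset.mem_coe, Finset.mem_range] at hi hj
      obtain ⟨rfl, rfl⟩ := hyinj i k j l (by omega) (by omega) (Subtype.ext hij)
      rfl
  · intro i j hij
    induction i using Fin.cases with
    | zero =>
      obtain ⟨j, rfl⟩ := Fin.exists_succ_eq.2 hij.symm
      exact hcopA j
    | succ i =>
      induction j using Fin.cases with
      | zero => exact (hcopA i).symm
      | succ j =>
        rw [hAs, hAs]
        exact hS.isCoprime (x i).2 (x j).2 fun h => hij (congrArg _ (hxinj (Subtype.ext h)))
  · intro i j hij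
    induction i using Fin.cases with
    | zero =>
      obtain ⟨j, rfl⟩ := Fin.exists_succ_eq.2 hij.symm
      exact hcopB j
    | succ i =>
      induction j using Fin.cases with
      | zero => exact (hcopB i).symm
      | succ j =>
        rw [hBs, hBs]
        refine IsCoprime.prod_left fun k hk => IsCoprime.prod_right fun l hl =>
          (hT.isCoprime (y i k).2 (y j l).2 fun h => hij ?_).pow
        rw [Finset.mem_range] at hk hl
        exact congrArg _ (hyinj i k j l (by omega) (by omega) (Subtype.ext h)).1
  · intro i
    refine ⟨fun k => if k ≤ m i + 1 then (y i (k - 1)).1 else (x i).1, ?_, ?_, ?_⟩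
    · intro k hk
      rw [Finset.mem_Icc] at hk
      change 1 ≤ k ∧ k ≤ m i + 1 + 1 at hk
      beta_reduce
      split_ifs with hkm
      · obtain ⟨k, rfl⟩ : ∃ j, k = j + 1 := ⟨k - 1, by omega⟩
        exact ⟨hT.monic _ (y i k).2, hT.irreducible _ (y i k).2, (hvdeg i k (by omega)).symm⟩
      · obtain rfl : k = m i + 1 + 1 := by omega
        exact ⟨hS.monic _ (x i).2, hS.irreducible _ (x i).2, (hvlast i).symm⟩
    · simp only [hAs]
      rw [if_neg]
      change ¬ m i + 1 + 1 ≤ m i + 1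
      omega
    · simp only [hBs]
      change _ = ∏ k ∈ Finset.Ico 1 (m i + 1 + 1), _
      rw [Finset.prod_Ico_eq_prod_range]
      refine Finset.prod_congr rfl fun k hk => ?_
      rw [Finset.mem_range] at hk
      rw [if_pos (by omega), add_comm 1 k, hvs, Nat.add_sub_cancel]
  · intro i
    rw [hv0]
    exact (hstart i).1
  · exact hSF.mem_exceptionalSet hTF (fun P hP => ⟨hf P (hS0S hP), (Finset.mem_filter.1 hP).2⟩)
      fun P hP => (Finset.mem_filter.1 hP).2
  · intro i
    rw [ExpTuple.Reduced, hv0, hvs i 0, mul_comm]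
    exact (hstart i).2

end Decompositions
end PhiSigma

namespace PhiSigma

/-! ### Lower bounds for the number of primes of given degree -/

section PrimeCount

open Polynomial

variable {K : Type*} [Field K] [Finite K]

theorem finite_primes_of_degree (k : ℕ) :
    {P : K[X] | P.Monic ∧ Irreducible P ∧ P.natDegree = k}.Finite :=
  (finite_setOf_natDegree_le k).subset fun _ hP => hP.2.2.le

variable (K) in
/-- The finite set of monic primes of degree `k`. -/
noncomputable def primesOfDegree (k : ℕ) : Finset K[X] := (finite_primes_of_degree k).toFinset

theorem mem_primesOfDegree {k : ℕ} {P : K[X]} :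
    P ∈ primesOfDegree K k ↔ P.Monic ∧ Irreducible P ∧ P.natDegree = k :=
  Set.Finite.mem_toFinset _

/-- Count the field with q^k elements: an element is a root of a prime of degree k, or its minimal
polynomial has degree a proper divisor j of k and it satisfies x^(q^j) = x. -/
theorem card_pow_le {k : ℕ} (hk : 0 < k) :
    Nat.card K ^ k ≤ k * (primesOfDegree K k).card + ∑ j ∈ k.properDivisors, Nat.card K ^ j := by
  classical
  obtain ⟨p, hp⟩ := CharP.exists K
  have : Fact p.Prime := ⟨CharP.char_is_prime K p⟩
  have : NeZero k := ⟨hk.ne'⟩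
  let L := FiniteField.Extension K p k
  have := Fintype.ofFinite L
  have hL : Fintype.card L = Nat.card K ^ k := by
    rw [← Nat.card_eq_fintype_card]
    exact FiniteField.natCard_extension K p k
  have hint : ∀ x : L, IsIntegral K x := fun x => Algebra.IsIntegral.isIntegral x
  have hcover : (Finset.univ : Finset L) ⊆
      ((primesOfDegree K k).biUnion fun P => (P.map (algebraMap K L)).roots.toFinset) ∪
        (k.properDivisors.biUnion fun j => (X ^ Nat.card K ^ j - X : L[X]).roots.toFinset) := by
    intro x _
    have hi := minpoly.irreducible (hint x)
    have hdvd : (minpoly K x).natDegree ∣ k := by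
      have := minpoly.degree_dvd (hint x)
      rwa [FiniteField.finrank_extension] at this
    rw [Finset.mem_union, Finset.mem_biUnion, Finset.mem_biUnion]
    rcases eq_or_ne (minpoly K x).natDegree k with h | h
    · left
      refine ⟨minpoly K x, mem_primesOfDegree.2 ⟨minpoly.monic (hint x), hi, h⟩, ?_⟩
      rw [Multiset.mem_toFinset, mem_roots (map_ne_zero hi.ne_zero), IsRoot.def, eval_map_algebraMap,
        minpoly.aeval]
    · right
      refine ⟨(minpoly K x).natDegree, Nat.mem_properDivisors.2
        ⟨hdvd, lt_of_le_of_ne (Nat.le_of_dvd hk hdvd) h⟩, ?_⟩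
      have h1 := hi.natDegree_dvd_iff_dvd_X_pow_card_pow_sub_X.1 (dvd_refl _)
      rw [minpoly.dvd_iff] at h1
      rw [Multiset.mem_toFinset, mem_roots (FiniteField.X_pow_card_pow_sub_X_ne_zero _
        hi.natDegree_pos.ne' Finite.one_lt_card), IsRoot.def]
      simpa using h1
  have h1 := Finset.card_le_card hcover
  rw [Finset.card_univ, hL] at h1
  refine h1.trans ((Finset.card_union_le _ _).trans (Nat.add_le_add ?_ ?_))
  · rw [mul_comm]
    refine Finset.card_biUnion_le_card_mul _ _ _ fun P hP => ?_
    refine (Multiset.toFinset_card_le _).trans ((card_roots' _).trans ?_)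
    rw [natDegree_map, (mem_primesOfDegree.1 hP).2.2]
  · refine Finset.card_biUnion_le.trans (Finset.sum_le_sum fun j hj => ?_)
    refine (Multiset.toFinset_card_le _).trans ((card_roots' _).trans ?_)
    have hj0 : j ≠ 0 := by
      rintro rfl
      have := (Nat.mem_properDivisors.1 hj).1
      rw [zero_dvd_iff] at this
      omega
    rw [FiniteField.X_pow_card_pow_sub_X_natDegree_eq _ hj0 Finite.one_lt_card]

/-- A lower bound for the number of monic primes of degree `k` over the field of two elements. -/
def capTwo (k : ℕ) : ℕ := if k = 2 then 1 else if k ∣ 6 then 2 else 3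

/-- A lower bound for the number of monic primes of degree `k` over the field of three elements. -/
def capThree (k : ℕ) : ℕ := if k = 1 then 3 else 2

/-- For k not dividing 6, proper divisors are at most k - 2, so the smaller fields hold at most
2^(k-1) - 2 elements; two primes of degree k would cover too few of the others. -/
theorem capTwo_le (hK : Nat.card K = 2) {k : ℕ} (hk : 0 < k) :
    capTwo k ≤ (primesOfDegree K k).card := by
  have h := card_pow_le (K := K) hk
  rw [hK] at h
  by_cases h6 : k ∣ 6
  · have : k ≤ 6 := Nat.le_of_dvd (by norm_num) h6
    interval_cases k
    · rw [show ∑ j ∈ Nat.properDivisors 1, 2 ^ j = 0 by decide] at h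
      rw [show capTwo 1 = 2 by decide]
      omega
    · rw [show ∑ j ∈ Nat.properDivisors 2, 2 ^ j = 2 by decide] at h
      rw [show capTwo 2 = 1 by decide]
      omega
    · rw [show ∑ j ∈ Nat.properDivisors 3, 2 ^ j = 2 by decide] at h
      rw [show capTwo 3 = 2 by decide]
      omega
    · omega
    · omega
    · rw [show ∑ j ∈ Nat.properDivisors 6, 2 ^ j = 14 by decide] at h
      rw [show capTwo 6 = 2 by decide]
      omega
  · have hk4 : 4 ≤ k := by
      by_contra hlt
      interval_cases k <;> simp at h6
    rw [capTwo, if_neg (by omega), if_neg h6]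
    have hsub : k.properDivisors ⊆ (Finset.range (k - 1)).erase 0 := by
      intro j hj
      rw [Nat.mem_properDivisors] at hj
      obtain ⟨⟨t, ht⟩, hjk⟩ := hj
      rw [Finset.mem_erase, Finset.mem_range]
      have hj0 : j ≠ 0 := by rintro rfl; omega
      have ht2 : 2 ≤ t := by
        by_contra hlt
        interval_cases t <;> omega
      have : j * 2 ≤ j * t := Nat.mul_le_mul_left j ht2
      omega
    have hsum := Finset.sum_le_sum_of_subset (f := fun j => 2 ^ j) hsub
    have hgeom : ∑ j ∈ Finset.range (k - 1), 2 ^ j = 2 ^ (k - 1) - 1 := by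
      simpa using Nat.geomSum_eq (le_refl 2) (k - 1)
    rw [← Finset.add_sum_erase _ _ (Finset.mem_range.2 (show 0 < k - 1 by omega))] at hgeom
    have hpow : 2 ^ k = 2 * 2 ^ (k - 1) := by rw [← pow_succ', Nat.sub_add_cancel hk]
    have hbig : ∀ t, 4 ≤ t → 2 * t ≤ 2 ^ (t - 1) := by
      intro t ht
      induction t, ht using Nat.le_induction with
      | base => norm_num
      | succ t ht ih =>
        rw [Nat.add_sub_cancel, ← Nat.sub_add_cancel (show 1 ≤ t by omega), pow_succ]
        omega
    have h2 := hbig k hk4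
    by_contra! hlt
    have h3 : k * (primesOfDegree K k).card ≤ k * 2 := Nat.mul_le_mul_left k (by omega)
    rw [pow_zero] at hgeom
    omega

theorem capThree_le (hK : Nat.card K = 3) {k : ℕ} (hk : 0 < k) :
    capThree k ≤ (primesOfDegree K k).card := by
  have h := card_pow_le (K := K) hk
  rw [hK] at h
  rcases (show k = 1 ∨ 2 ≤ k by omega) with rfl | hk2
  · rw [show ∑ j ∈ Nat.properDivisors 1, 3 ^ j = 0 by decide] at h
    rw [show capThree 1 = 3 by decide]
    omega
  · rw [capThree, if_neg (by omega)]
    have hsub : k.properDivisors ⊆ (Finset.range k).erase 0 := by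
      intro j hj
      rw [Nat.mem_properDivisors] at hj
      rw [Finset.mem_erase, Finset.mem_range]
      refine ⟨?_, hj.2⟩
      rintro rfl
      have := zero_dvd_iff.1 hj.1
      omega
    have hsum := Finset.sum_le_sum_of_subset (f := fun j => 3 ^ j) hsub
    have hgeom : 2 * ∑ j ∈ Finset.range k, 3 ^ j = 3 ^ k - 1 := by
      rw [Nat.geomSum_eq (by norm_num) k]
      exact Nat.mul_div_cancel' (by simpa using Nat.sub_dvd_pow_sub_pow 3 1 k)
    rw [← Finset.add_sum_erase _ _ (Finset.mem_range.2 hk), pow_zero] at hgeom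
    have hbig : ∀ t, 2 ≤ t → 4 * t + 1 ≤ 3 ^ t := by
      intro t ht
      induction t, ht using Nat.le_induction with
      | base => norm_num
      | succ t ht ih => rw [pow_succ]; omega
    have h2 := hbig k hk2
    by_contra! hlt
    have h3 : k * (primesOfDegree K k).card ≤ k * 1 := Nat.mul_le_mul_left k (by omega)
    omega

/-- `R k i`, `i < cap k`, are distinct monic primes of degree `k`. -/
structure IsPrimeTable (cap : ℕ → ℕ) (R : ℕ × ℕ → K[X]) : Prop where
  monic : ∀ a : ℕ × ℕ, 0 < a.1 → a.2 < cap a.1 → (R a).Monic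
  irreducible : ∀ a : ℕ × ℕ, 0 < a.1 → a.2 < cap a.1 → Irreducible (R a)
  natDegree_eq : ∀ a : ℕ × ℕ, 0 < a.1 → a.2 < cap a.1 → (R a).natDegree = a.1
  inj : ∀ a b : ℕ × ℕ, 0 < a.1 → a.2 < cap a.1 → 0 < b.1 → b.2 < cap b.1 → R a = R b → a = b

theorem exists_isPrimeTable {cap : ℕ → ℕ}
    (h : ∀ k, 0 < k → cap k ≤ (primesOfDegree K k).card) :
    ∃ R : ℕ × ℕ → K[X], IsPrimeTable cap R := by
  let R : ℕ × ℕ → K[X] := fun a =>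
    if h : a.2 < (primesOfDegree K a.1).card then
      ((primesOfDegree K a.1).equivFin.symm ⟨a.2, h⟩).1 else 0
  have hR : ∀ a : ℕ × ℕ, ∀ h : a.2 < (primesOfDegree K a.1).card,
      R a = ((primesOfDegree K a.1).equivFin.symm ⟨a.2, h⟩).1 := fun a h => dif_pos h
  have hmem : ∀ a : ℕ × ℕ, 0 < a.1 → a.2 < cap a.1 → R a ∈ primesOfDegree K a.1 := by
    intro a ha ha'
    rw [hR a (ha'.trans_le (h _ ha))]
    exact Subtype.prop _
  have hdeg : ∀ a : ℕ × ℕ, 0 < a.1 → a.2 < cap a.1 → (R a).natDegree = a.1 :=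
    fun a ha ha' => (mem_primesOfDegree.1 (hmem a ha ha')).2.2
  refine ⟨R, fun a ha ha' => (mem_primesOfDegree.1 (hmem a ha ha')).1,
    fun a ha ha' => (mem_primesOfDegree.1 (hmem a ha ha')).2.1, hdeg, ?_⟩
  rintro ⟨k, i⟩ ⟨l, j⟩ ha ha' hb hb' heq
  obtain rfl : k = l := by
    have h1 := hdeg (k, i) ha ha'
    rw [heq, hdeg (l, j) hb hb'] at h1
    exact h1.symm
  rw [hR _ (ha'.trans_le (h _ ha)), hR _ (hb'.trans_le (h _ hb))] at heq
  have := (primesOfDegree K k).equivFin.symm.injective (Subtype.ext heq)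
  exact Prod.ext rfl (congrArg Fin.val this)

end PrimeCount

/-! ### Solutions assembled from a table of primes -/

section Occurrence

open Polynomial

/-- `k` is the degree of one of the primes of a chain of type `v`. -/
def ExpTuple.Uses (v : ExpTuple) (k : ℕ) : Prop :=
  ∃ j, 1 ≤ j ∧ j ≤ v.len + 1 ∧ v.deg j = k

theorem ExpTuple.Uses.pos {v : ExpTuple} {k : ℕ} (h : v.Uses k) : 0 < k := by
  obtain ⟨j, -, -, rfl⟩ := h
  exact v.deg_pos j

theorem ExpTuple.val_zero_le_deg (v : ExpTuple) (j : ℕ) : v.val 0 ≤ v.deg j :=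
  Nat.le_mul_of_pos_right _ (Finset.prod_pos fun _ _ => Nat.succ_pos _)

/-- The second degree v_0(v_1 + 1) divides all later ones. -/
theorem ExpTuple.Reduced.not_deg_dvd {d : ℕ} {v : ExpTuple} (h : v.Reduced d) {j : ℕ}
    (hj : 2 ≤ j) : ¬ v.deg j ∣ d := by
  have h2 : v.deg 2 ∣ v.deg j := by
    induction j, hj using Nat.le_induction with
    | base => exact dvd_rfl
    | succ j hj ih =>
      rw [v.deg_succ (k := j) (by omega)]
      exact ih.mul_left _
  intro hd
  refine h (dvd_trans ?_ (h2.trans hd))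
  rw [v.deg_succ (k := 1) le_rfl, v.deg_one, mul_comm]

theorem ExpTuple.Reduced.eq_of_deg_dvd {d : ℕ} {v : ExpTuple} (h : v.Reduced d) {j : ℕ}
    (hj : 1 ≤ j) (hd : v.deg j ∣ d) : v.deg j = v.val 0 := by
  rcases hj.eq_or_lt with rfl | hlt
  · exact v.deg_one
  · exact absurd hd (h.not_deg_dvd hlt)

theorem ExpTuple.Reduced.eq_of_uses {d : ℕ} {v : ExpTuple} (h : v.Reduced d) {k : ℕ}
    (hk : v.Uses k) (hd : k ∣ d) : k = v.val 0 := by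
  obtain ⟨j, hj, -, rfl⟩ := hk
  exact h.eq_of_deg_dvd hj hd

variable {K : Type*} [Field K]

theorem isFactorization_prod_image {cap : ℕ → ℕ} {R : ℕ × ℕ → K[X]} (hR : IsPrimeTable cap R)
    (W : Finset (ℕ × ℕ)) (e : ℕ × ℕ → ℕ) (hW : ∀ a ∈ W, 0 < a.1 ∧ a.2 < cap a.1 ∧ 0 < e a) :
    ∃ S f, IsFactorization (∏ a ∈ W, R a ^ e a) S f ∧
      ∀ P ∈ S, ∃ a ∈ W, P = R a ∧ f P = e a := by
  classical
  have hinj : Set.InjOn R W := fun a ha b hb hab =>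
    hR.inj a b (hW a ha).1 (hW a ha).2.1 (hW b hb).1 (hW b hb).2.1 hab
  have hinv : ∀ a ∈ W, Function.invFunOn R W (R a) = a := fun a ha =>
    hinj.leftInvOn_invFunOn ha
  refine ⟨W.image R, fun P => e (Function.invFunOn R W P), ⟨?_, ?_, ?_, 1, one_ne_zero, ?_⟩, ?_⟩
  · intro P hP
    obtain ⟨a, ha, rfl⟩ := Finset.mem_image.1 hP
    exact hR.monic a (hW a ha).1 (hW a ha).2.1
  · intro P hP
    obtain ⟨a, ha, rfl⟩ := Finset.mem_image.1 hP
    exact hR.irreducible a (hW a ha).1 (hW a ha).2.1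
  · intro P hP
    obtain ⟨a, ha, rfl⟩ := Finset.mem_image.1 hP
    rw [hinv a ha]
    exact (hW a ha).2.2
  · rw [Finset.prod_image hinj, C_1, one_mul]
    exact Finset.prod_congr rfl fun a ha => by rw [hinv a ha]
  · intro P hP
    obtain ⟨a, ha, rfl⟩ := Finset.mem_image.1 hP
    exact ⟨a, ha, rfl, congrArg e (hinv a ha)⟩

/-- A solution is obtained by selecting primes from a table: the chain `i` uses, in degree `k`, the
prime with index `idx i k`, and the exceptional pair is `(∏_U R, ∏_W R ^ e)`. -/
theorem occurs_of_table [Finite K] {d n : ℕ} {cap : ℕ → ℕ} {R : ℕ × ℕ → K[X]} (hR : IsPrimeTable cap R)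
    (v : Fin n → ExpTuple) (hv : ∀ i, (v i).val 0 ∣ d) (idx : Fin n → ℕ → ℕ)
    (U W : Finset (ℕ × ℕ)) (e : ℕ × ℕ → ℕ)
    (hidx : ∀ i k, (v i).Uses k → idx i k < cap k)
    (hne : ∀ i j, i ≠ j → ∀ k, (v i).Uses k → (v j).Uses k → idx i k ≠ idx j k)
    (hU : ∀ a ∈ U, 0 < a.1 ∧ a.2 < cap a.1 ∧ a.1 ∣ d)
    (hW : ∀ a ∈ W, 0 < a.1 ∧ a.2 < cap a.1 ∧ 0 < e a ∧ (e a + 1) * a.1 ∣ d)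
    (hUend : ∀ i, ∀ a ∈ U, (v i).deg ((v i).len + 1) = a.1 → idx i a.1 ≠ a.2)
    (hWuse : ∀ i, ∀ a ∈ W, ∀ j, 1 ≤ j → j ≤ (v i).len → (v i).deg j = a.1 → idx i a.1 ≠ a.2)
    (heq : (∏ a ∈ U, (Nat.card K ^ a.1 - 1)) * (∏ i, (Nat.card K ^ (v i).val 0 - 1)) *
      ∏ a ∈ W, (Nat.card K ^ a.1 - 1) = ∏ a ∈ W, (Nat.card K ^ ((e a + 1) * a.1) - 1)) :
    Occurs K d v := by
  classical
  obtain ⟨S, f, hS, hSR⟩ := isFactorization_prod_image hR U (fun _ => 1)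
    fun a ha => ⟨(hU a ha).1, (hU a ha).2.1, one_pos⟩
  obtain ⟨T, g, hT, hTR⟩ := isFactorization_prod_image hR W e
    fun a ha => ⟨(hW a ha).1, (hW a ha).2.1, (hW a ha).2.2.1⟩
  simp only [pow_one] at hS
  have hcop : ∀ a b : ℕ × ℕ, 0 < a.1 → a.2 < cap a.1 → 0 < b.1 → b.2 < cap b.1 → a ≠ b →
      IsCoprime (R a) (R b) := fun a b ha ha' hb hb' hab =>
    isCoprime_of_monic_irreducible (hR.monic a ha ha') (hR.monic b hb hb')
      (hR.irreducible a ha ha') (hR.irreducible b hb hb') fun h => hab (hR.inj a b ha ha' hb hb' h)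
  -- Degrees increase along a chain, so one index per degree determines its primes.
  let p : Fin n → ℕ → K[X] := fun i j => R ((v i).deg j, idx i ((v i).deg j))
  have huse : ∀ i j, 1 ≤ j → j ≤ (v i).len + 1 → (v i).Uses ((v i).deg j) :=
    fun i j hj hj' => ⟨j, hj, hj', rfl⟩
  have hcap : ∀ i j, 1 ≤ j → j ≤ (v i).len + 1 →
      idx i ((v i).deg j) < cap ((v i).deg j) := fun i j hj hj' => hidx i _ (huse i j hj hj')
  have hpcop : ∀ i i', i ≠ i' → ∀ j j', 1 ≤ j → j ≤ (v i).len + 1 → 1 ≤ j' →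
      j' ≤ (v i').len + 1 → IsCoprime (p i j) (p i' j') := by
    intro i i' hii j j' hj hjl hj' hjl'
    refine hcop _ _ ((v i).deg_pos j) (hcap i j hj hjl) ((v i').deg_pos j') (hcap i' j' hj' hjl') ?_
    intro h
    obtain ⟨h1, h2⟩ := Prod.ext_iff.1 h
    simp only at h1 h2
    rw [← h1] at h2
    exact hne i i' hii _ (huse i j hj hjl) (h1 ▸ huse i' j' hj' hjl') h2
  let A : Fin (n + 1) → K[X] := Fin.cons (∏ a ∈ U, R a) fun i => p i ((v i).len + 1)
  let B : Fin (n + 1) → K[X] := Fin.cons (∏ a ∈ W, R a ^ e a) fun i =>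
    ∏ k ∈ Finset.Icc 1 (v i).len, p i k ^ (v i).val k
  have hA0 : A 0 = ∏ a ∈ U, R a := rfl
  have hAs : ∀ i : Fin n, A i.succ = p i ((v i).len + 1) := fun _ => rfl
  have hB0 : B 0 = ∏ a ∈ W, R a ^ e a := rfl
  have hBs : ∀ i : Fin n, B i.succ = ∏ k ∈ Finset.Icc 1 (v i).len, p i k ^ (v i).val k :=
    fun _ => rfl
  -- F_0 need only avoid the last primes of chains, and G_0 only the earlier ones; F_0 and G_0 may
  -- share primes with each other.
  have hcopA : ∀ i : Fin n, IsCoprime (A 0) (A i.succ) := by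
    intro i
    rw [hA0, hAs]
    refine IsCoprime.prod_left fun a ha => hcop _ _ (hU a ha).1 (hU a ha).2.1 ((v i).deg_pos _)
      (hcap i _ (by omega) le_rfl) ?_
    rintro rfl
    exact hUend i _ ha rfl rfl
  have hcopB : ∀ i : Fin n, IsCoprime (B 0) (B i.succ) := by
    intro i
    rw [hB0, hBs]
    refine IsCoprime.prod_left fun a ha => IsCoprime.prod_right fun j hj => IsCoprime.pow ?_
    rw [Finset.mem_Icc] at hj
    refine hcop _ _ (hW a ha).1 (hW a ha).2.1 ((v i).deg_pos _) (hcap i _ hj.1 (by omega)) ?_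
    rintro rfl
    exact hWuse i _ ha j hj.1 hj.2 rfl rfl
  have hpm : ∀ i j, 1 ≤ j → j ≤ (v i).len + 1 → (p i j).Monic := fun i j hj hj' =>
    hR.monic _ ((v i).deg_pos j) (hcap i j hj hj')
  have hdec : IsDecomposition d (∏ i, A i) (∏ i, B i) v A B := by
    refine ⟨rfl, rfl, ?_, ?_, ?_, hv⟩
    · intro i j hij
      induction i using Fin.cases with
      | zero =>
        obtain ⟨j, rfl⟩ := Fin.exists_succ_eq.2 hij.symm
        exact hcopA j
      | succ i =>
        induction j using Fin.cases with
        | zero => exact (hcopA i).symm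
        | succ j =>
          rw [hAs, hAs]
          exact hpcop i j (fun h => hij (congrArg _ h)) _ _ (by omega) le_rfl (by omega) le_rfl
    · intro i j hij
      induction i using Fin.cases with
      | zero =>
        obtain ⟨j, rfl⟩ := Fin.exists_succ_eq.2 hij.symm
        exact hcopB j
      | succ i =>
        induction j using Fin.cases with
        | zero => exact (hcopB i).symm
        | succ j =>
          rw [hBs, hBs]
          refine IsCoprime.prod_left fun k hk => IsCoprime.prod_right fun l hl => IsCoprime.pow ?_
          rw [Finset.mem_Icc] at hk hl
          exact hpcop i j (fun h => hij (congrArg _ h)) _ _ hk.1 (by omega) hl.1 (by omega)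
    · intro i
      refine ⟨p i, fun k hk => ?_, hAs i, hBs i⟩
      rw [Finset.mem_Icc] at hk
      exact ⟨hpm i k hk.1 hk.2, hR.irreducible _ ((v i).deg_pos k) (hcap i k hk.1 hk.2),
        hR.natDegree_eq _ ((v i).deg_pos k) (hcap i k hk.1 hk.2)⟩
  refine ⟨∏ i, A i, ∏ i, B i, A, B, ?_, ?_, ?_, hdec, ?_⟩
  · refine monic_prod_of_monic _ _ fun i _ => ?_
    induction i using Fin.cases with
    | zero => exact monic_prod_of_monic _ _ fun a ha => hR.monic a (hU a ha).1 (hU a ha).2.1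
    | succ i => exact hpm i _ (by omega) le_rfl
  · refine monic_prod_of_monic _ _ fun i _ => ?_
    induction i using Fin.cases with
    | zero => exact monic_prod_of_monic _ _ fun a ha => (hR.monic a (hW a ha).1 (hW a ha).2.1).pow _
    | succ i =>
      rw [hBs]
      refine monic_prod_of_monic _ _ fun k hk => ?_
      rw [Finset.mem_Icc] at hk
      exact (hpm i k hk.1 (by omega)).pow _
  · rw [hdec.phi_eq_sigma_iff hT.ne_zero, hA0, hB0]
    rw [phi_prod U R fun a ha b hb hab =>
        hcop a b (hU a ha).1 (hU a ha).2.1 (hU b hb).1 (hU b hb).2.1 hab,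
      sigma_prod W _ (fun a ha => pow_ne_zero _ (hR.monic a (hW a ha).1 (hW a ha).2.1).ne_zero)
        fun a ha b hb hab =>
          (hcop a b (hW a ha).1 (hW a ha).2.1 (hW b hb).1 (hW b hb).2.1 hab).pow]
    -- The numerical hypothesis has the denominators of σ(G_0) cleared; they are cancelled here.
    have hpos : ∏ a ∈ W, (Nat.card K ^ a.1 - 1) ≠ 0 := Finset.prod_ne_zero_iff.2 fun a ha =>
      Nat.sub_ne_zero_of_lt (Nat.one_lt_pow (hW a ha).1.ne' Finite.one_lt_card)
    refine Nat.eq_of_mul_eq_mul_right (Nat.pos_of_ne_zero hpos) ?_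
    rw [Finset.prod_congr rfl fun a ha => by
      rw [phi_irreducible (hR.irreducible a (hU a ha).1 (hU a ha).2.1),
        hR.natDegree_eq a (hU a ha).1 (hU a ha).2.1], heq, ← Finset.prod_mul_distrib]
    refine Finset.prod_congr rfl fun a ha => ?_
    have := pow_sub_one_mul_sigma_pow (hR.monic a (hW a ha).1 (hW a ha).2.1)
      (hR.irreducible a (hW a ha).1 (hW a ha).2.1) (e a)
    rw [hR.natDegree_eq a (hW a ha).1 (hW a ha).2.1] at this
    rw [← this, mul_comm]
  · refine hS.mem_exceptionalSet hT (fun P hP => ?_) fun P hP => ?_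
    · obtain ⟨a, ha, rfl, h⟩ := hSR P hP
      rw [hR.natDegree_eq a (hU a ha).1 (hU a ha).2.1]
      exact ⟨h, (hU a ha).2.2⟩
    · obtain ⟨a, ha, rfl, h⟩ := hTR P hP
      rw [hR.natDegree_eq a (hW a ha).1 (hW a ha).2.1, h]
      exact (hW a ha).2.2.2

end Occurrence
end PhiSigma

namespace PhiSigma

/-! ### Explicit exceptional pairs for q = 2 and q = 3 -/

section TableData

variable {K : Type*} [Field K]

theorem isPrimeTable_two [Finite K] (hK : Nat.card K = 2) :
    ∃ R : ℕ × ℕ → K[X], IsPrimeTable capTwo R :=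
  exists_isPrimeTable fun _ hk => capTwo_le hK hk

theorem isPrimeTable_three [Finite K] (hK : Nat.card K = 3) :
    ∃ R : ℕ × ℕ → K[X], IsPrimeTable capThree R :=
  exists_isPrimeTable fun _ hk => capThree_le hK hk

theorem lt_capTwo {k i : ℕ} (hi : i < 2) (hk : k ≠ 2) : i < capTwo k := by
  rw [capTwo, if_neg hk]
  split_ifs <;> omega

theorem lt_capThree {k i : ℕ} (hi : i < 2) : i < capThree k := by
  rw [capThree]
  split_ifs <;> omega

/-- At most two chains over the field of two elements: the `i`-th one is extended backwards to
degree one. -/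
theorem occurs_two_of_le_two (hK : Nat.card K = 2) {n : ℕ} (hn : n ≤ 2) (v : Fin n → ExpTuple)
    (hv : ∀ i, (v i).val 0 ∣ 6)
    (h2 : ∀ i j, i ≠ j → ¬ ((v i).Uses 2 ∧ (v j).Uses 2)) : Occurs K 6 v := by
  classical
  have : Finite K := Nat.finite_of_card_ne_zero (by omega)
  obtain ⟨R, hR⟩ := isPrimeTable_two hK
  set I : Finset (Fin n) := Finset.univ.filter fun i => (v i).val 0 ≠ 1 with hI
  have hpos : ∀ i, 0 < (v i).val 0 := fun i => (v i).val_pos 0 (Nat.zero_le _)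
  have hinj : Set.InjOn (fun i : Fin n => ((1, i.1) : ℕ × ℕ)) I := fun i _ j _ hij =>
    Fin.ext (Prod.ext_iff.1 hij).2
  -- For a linear prime P, σ(P^(v_0-1)) = 2^v_0 - 1 is exactly the factor contributed by the chain,
  -- and F_0 = 1 works. Chains with v_0 = 1 contribute 1 and need no such prime.
  let e : ℕ × ℕ → ℕ := fun a => if h : a.2 < n then (v ⟨a.2, h⟩).val 0 - 1 else 0
  have he : ∀ i : Fin n, e (1, i.1) = (v i).val 0 - 1 := fun i => dif_pos i.2
  -- Chain i takes index i in every degree except 2, where there is only one prime and only one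
  -- chain needs it.
  refine occurs_of_table hR v hv (fun i k => if k = 2 then 0 else i.1) ∅
    (I.image fun i => (1, i.1)) e ?_ ?_ ?_ ?_ ?_ ?_ ?_
  · intro i k _
    split_ifs with h
    · subst h; decide
    · exact lt_capTwo (by omega) h
  · intro i j hij k hi hj
    have hk : k ≠ 2 := by rintro rfl; exact h2 i j hij ⟨hi, hj⟩
    simp only [if_neg hk]
    exact fun h => hij (Fin.ext h)
  · simp
  · intro a ha
    obtain ⟨i, hi, rfl⟩ := Finset.mem_image.1 ha
    have h1 := (Finset.mem_filter.1 hi).2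
    have h3 := hpos i
    rw [he]
    refine ⟨one_pos, lt_capTwo (by have := i.2; simp only; omega) (by norm_num), by omega, ?_⟩
    rw [mul_one, Nat.sub_add_cancel h3]
    exact hv i
  · simp
  · intro i' a ha j _ _ hdeg
    obtain ⟨i, hi, rfl⟩ := Finset.mem_image.1 ha
    have h1 := (Finset.mem_filter.1 hi).2
    intro h
    simp only at hdeg h
    rw [if_neg (by norm_num)] at h
    obtain rfl : i' = i := Fin.ext h
    have h3 := (v i').val_zero_le_deg j
    have h4 := hpos i'
    omega
  · rw [Finset.prod_empty, one_mul, Finset.prod_image hinj, Finset.prod_image hinj, hK]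
    simp only [pow_one, mul_one, he]
    norm_num
    rw [← Finset.prod_subset (Finset.subset_univ I)]
    · exact Finset.prod_congr rfl fun i _ => by rw [Nat.sub_add_cancel (hpos i)]
    · intro i _ hi
      have : (v i).val 0 = 1 := by
        by_contra h
        exact hi (Finset.mem_filter.2 ⟨Finset.mem_univ i, h⟩)
      norm_num [this]

theorem eq_of_dvd_six {k : ℕ} (h : k ∣ 6) : k = 1 ∨ k = 2 ∨ k = 3 ∨ k = 6 := by
  have := Nat.le_of_dvd (by norm_num) h
  interval_cases k <;> simp_all

/-- Three reduced chains over the field of two elements, from numerical data. -/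
theorem occurs_two_three (hK : Nat.card K = 2) (v : Fin 3 → ExpTuple)
    (hv : ∀ i, (v i).val 0 ∣ 6) (hred : ∀ i, (v i).Reduced 6) (hv2 : (v 2).val 0 = 1)
    (h22 : ¬ ((v 0).val 0 = 2 ∧ (v 1).val 0 = 2)) (h11 : ¬ ((v 0).val 0 = 1 ∧ (v 1).val 0 = 1))
    {a b : ℕ} (ha : (v 0).val 0 = a) (hb : (v 1).val 0 = b) (W : Finset (ℕ × ℕ)) (e : ℕ × ℕ → ℕ)
    (hW : ∀ w ∈ W, w.1 ∣ 6 ∧ 0 < w.1 ∧ w.2 < capTwo w.1 ∧ 0 < e w ∧ (e w + 1) * w.1 ∣ 6 ∧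
      (w.1 = a → w.2 ≠ 0) ∧ (w.1 = b → w.2 ≠ if b = 3 ∨ b = 6 then 1 else 0) ∧ w ≠ (1, 1))
    (heq : 3 * ((2 ^ a - 1) * (2 ^ b - 1)) * ∏ w ∈ W, (2 ^ w.1 - 1) =
      ∏ w ∈ W, (2 ^ ((e w + 1) * w.1) - 1)) : Occurs K 6 v := by
  have : Finite K := Nat.finite_of_card_ne_zero (by omega)
  obtain ⟨R, hR⟩ := isPrimeTable_two hK
  -- Chains 0 and 1 get equal indices only in degrees 1 and 2, where at most one of them has a
  -- prime. Chain 2 starts at the second linear prime and then uses only degrees not dividing 6; its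
  -- other values just stay below the cap.
  let idx : Fin 3 → ℕ → ℕ := ![fun _ => 0, fun k => if k = 1 ∨ k = 2 then 0 else 1,
    fun k => if k = 2 then 0 else if k ∣ 6 then 1 else 2]
  have hidx1 : ∀ k, idx 1 k = if k = 1 ∨ k = 2 then 0 else 1 := fun _ => rfl
  have hidx0 : ∀ k, idx 0 k = 0 := fun _ => rfl
  have hidx2 : ∀ k, idx 2 k = if k = 2 then 0 else if k ∣ 6 then 1 else 2 := fun _ => rfl
  have huse : ∀ i k, (v i).Uses k → k ∣ 6 → k = (v i).val 0 := fun i k hk hd =>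
    (hred i).eq_of_uses hk hd
  have h01 : ∀ k, (v 0).Uses k → (v 1).Uses k → idx 0 k ≠ idx 1 k := by
    intro k h0 h1
    rw [hidx0, hidx1, if_neg]
    · norm_num
    · rintro (rfl | rfl)
      · exact h11 ⟨(huse 0 1 h0 (by norm_num)).symm, (huse 1 1 h1 (by norm_num)).symm⟩
      · exact h22 ⟨(huse 0 2 h0 (by norm_num)).symm, (huse 1 2 h1 (by norm_num)).symm⟩
  have h2k : ∀ k, (v 2).Uses k → idx 2 k = if k = 1 then 1 else 2 := by
    intro k hk
    rw [hidx2]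
    by_cases h6 : k ∣ 6
    · have := huse 2 k hk h6
      rw [hv2] at this
      subst this
      decide
    · have h1 : k ≠ 1 := by rintro rfl; exact h6 (by norm_num)
      have h2 : k ≠ 2 := by rintro rfl; exact h6 (by norm_num)
      rw [if_neg h2, if_neg h6, if_neg h1]
  have h02 : ∀ k, (v 2).Uses k → idx 0 k ≠ idx 2 k := by
    intro k hk
    rw [h2k k hk, hidx0]
    split_ifs <;> norm_num
  have h12 : ∀ k, (v 2).Uses k → idx 1 k ≠ idx 2 k := by
    intro k hk
    rw [h2k k hk, hidx1]
    by_cases h : k = 1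
    · simp [h]
    · rw [if_neg h]
      split_ifs <;> norm_num
  -- F_0 is the quadratic prime, whence the factor 3. No chain ends in degree 2, since the chains
  -- are reduced.
  refine occurs_of_table hR v hv idx {(2, 0)} W e ?_ ?_ ?_ ?_ ?_ ?_ ?_
  · intro i k hk
    have hk0 := hk.pos
    fin_cases i
    · change 0 < capTwo k
      rw [capTwo]
      split_ifs <;> norm_num
    · change (if k = 1 ∨ k = 2 then 0 else 1) < capTwo k
      rw [capTwo]
      split_ifs <;> omega
    · change (if k = 2 then 0 else if k ∣ 6 then 1 else 2) < capTwo k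
      rw [capTwo]
      split_ifs <;> norm_num
  · intro i j hij k hi hj
    fin_cases i <;> fin_cases j
    · exact absurd rfl hij
    · exact h01 k hi hj
    · exact h02 k hj
    · exact (h01 k hj hi).symm
    · exact absurd rfl hij
    · exact h12 k hj
    · exact (h02 k hi).symm
    · exact (h12 k hi).symm
    · exact absurd rfl hij
  · intro w hw
    obtain rfl := Finset.mem_singleton.1 hw
    decide
  · intro w hw
    obtain ⟨-, h1, h2, h3, h4, -⟩ := hW w hw
    exact ⟨h1, h2, h3, h4⟩
  · intro i w hw hdeg
    obtain rfl := Finset.mem_singleton.1 hw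
    have := (v i).one_le_len
    exact absurd (hdeg ▸ (by norm_num : (2 : ℕ) ∣ 6)) ((hred i).not_deg_dvd (j := (v i).len + 1)
      (by omega))
  · intro i w hw j hj _ hdeg
    obtain ⟨h6, -, -, -, -, h0, h1, h2⟩ := hW w hw
    have hd := (hred i).eq_of_deg_dvd hj (hdeg ▸ h6)
    rw [hdeg] at hd
    fin_cases i
    · exact (h0 (hd.trans ha)).symm
    · have h3 := h1 (hd.trans hb)
      have hb6 : b ∣ 6 := hb ▸ hv 1
      have hwb : w.1 = b := hd.trans hb
      change (if w.1 = 1 ∨ w.1 = 2 then 0 else 1) ≠ w.2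
      rw [hwb]
      refine (h3.trans_eq ?_).symm
      rcases eq_of_dvd_six hb6 with h | h | h | h <;> rw [h] <;> rfl
    · change (if w.1 = 2 then 0 else if w.1 ∣ 6 then 1 else 2) ≠ w.2
      have hw1 : w.1 = 1 := hd.trans hv2
      rw [hw1]
      intro h
      refine h2 (Prod.ext hw1 ?_)
      simpa using h.symm
  · rw [Fin.prod_univ_three, ha, hb, hv2, hK, Finset.prod_singleton]
    simpa using heq

/-- One needs σ(G_0) = 3(2^a - 1)(2^b - 1). The available factors are 63 = σ(P^5) and 7 = σ(P^2) for
P linear, 21 = σ(P^2) for P quadratic and 9 = σ(P) for P cubic; for instance 3·7·7 = 7·21 and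
3·63·63 = 63·21·9. -/
theorem occurs_two_of_three (hK : Nat.card K = 2) (v : Fin 3 → ExpTuple)
    (hv : ∀ i, (v i).val 0 ∣ 6) (hred : ∀ i, (v i).Reduced 6) (hv2 : (v 2).val 0 = 1)
    (h22 : ¬ ((v 0).val 0 = 2 ∧ (v 1).val 0 = 2)) (h11 : ¬ ((v 0).val 0 = 1 ∧ (v 1).val 0 = 1)) :
    Occurs K 6 v := by
  have key := fun {a b} => occurs_two_three (a := a) (b := b) hK v hv hred hv2 h22 h11
  -- Quadratic and cubic primes always get target 6; l is the exponent of the linear prime, and 0 is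
  -- a filler when there is none.
  let e : ℕ → ℕ × ℕ → ℕ := fun l w => if w.1 = 1 then l else if w.1 = 2 then 2 else 1
  rcases eq_of_dvd_six (hv 0) with h0 | h0 | h0 | h0 <;>
    rcases eq_of_dvd_six (hv 1) with h1 | h1 | h1 | h1
  · exact absurd ⟨h0, h1⟩ h11
  · exact key h0 h1 {(3, 0)} (e 0) (by decide) (by decide)
  · exact key h0 h1 {(2, 0)} (e 0) (by decide) (by decide)
  · exact key h0 h1 {(2, 0), (3, 0)} (e 0) (by decide) (by decide)
  · exact key h0 h1 {(3, 0)} (e 0) (by decide) (by decide)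
  · exact absurd ⟨h0, h1⟩ h22
  · exact key h0 h1 {(1, 0)} (e 5) (by decide) (by decide)
  · exact key h0 h1 {(1, 0), (3, 0)} (e 5) (by decide) (by decide)
  · exact key h0 h1 {(2, 0)} (e 0) (by decide) (by decide)
  · exact key h0 h1 {(1, 0)} (e 5) (by decide) (by decide)
  · exact key h0 h1 {(1, 0), (2, 0)} (e 2) (by decide) (by decide)
  · exact key h0 h1 {(1, 0), (2, 0)} (e 5) (by decide) (by decide)
  · exact key h0 h1 {(2, 0), (3, 0)} (e 0) (by decide) (by decide)
  · exact key h0 h1 {(1, 0), (3, 0)} (e 5) (by decide) (by decide)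
  · exact key h0 h1 {(1, 0), (2, 0)} (e 5) (by decide) (by decide)
  · exact key h0 h1 {(1, 0), (2, 0), (3, 0)} (e 5) (by decide) (by decide)

/-- Chains over the field of three elements, from numerical data. -/
theorem occurs_three_of_data (hK : Nat.card K = 3) {n : ℕ} (hn : n ≤ 2) (v : Fin n → ExpTuple)
    (hv : ∀ i, (v i).val 0 ∣ 2) (U W : Finset (ℕ × ℕ)) (hU : ∀ w ∈ U, w = (1, 2))
    (hW : ∀ w ∈ W, w.1 = 1 ∧ w.2 < 3)
    (hWv : ∀ i : Fin n, (v i).val 0 = 1 → (1, i.1) ∉ W)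
    (heq : (∏ w ∈ U, (3 ^ w.1 - 1)) * (∏ i, (3 ^ (v i).val 0 - 1)) * ∏ w ∈ W, (3 ^ w.1 - 1) =
      ∏ w ∈ W, (3 ^ (2 * w.1) - 1)) : Occurs K 2 v := by
  have : Finite K := Nat.finite_of_card_ne_zero (by omega)
  obtain ⟨R, hR⟩ := isPrimeTable_three hK
  -- As n ≤ 2, the chains use indices 0 and 1 only, so the linear prime of index 2 is always free
  -- for F_0 and G_0.
  refine occurs_of_table hR v hv (fun i _ => i.1) U W (fun _ => 1) ?_ ?_ ?_ ?_ ?_ ?_ ?_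
  · intro i k _
    exact lt_capThree (by have := i.2; omega)
  · intro i j hij k _ _ h
    exact hij (Fin.ext h)
  · intro w hw
    rw [hU w hw]
    decide
  · rintro ⟨k, j⟩ hw
    obtain ⟨rfl, h2⟩ := hW _ hw
    exact ⟨one_pos, h2, one_pos, dvd_rfl⟩
  · intro i w hw _ h
    rw [hU w hw] at h
    have := i.2
    simp only at h
    omega
  · rintro i ⟨k, j⟩ hw l _ _ hdeg h
    obtain ⟨rfl, h2⟩ := hW _ hw
    simp only at hdeg h h2
    have h3 := (v i).val_zero_le_deg l
    have h4 := (v i).val_pos 0 (Nat.zero_le _)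
    exact hWv i (by omega) (h ▸ hw)
  · rw [hK]
    exact heq

theorem eq_of_dvd_two {k : ℕ} (h : k ∣ 2) : k = 1 ∨ k = 2 := by
  have := Nat.le_of_dvd (by norm_num) h
  interval_cases k <;> simp_all

/-- Each linear prime of G_0 contributes σ(P) = 4, a chain contributes 2 or 8, and a linear F_0
contributes 2. F_0 is linear exactly when n = 1, which makes the left side a power of 4. -/
theorem occurs_three (hK : Nat.card K = 3) {n : ℕ} (hn : n ≤ 2) (v : Fin n → ExpTuple)
    (hv : ∀ i, (v i).val 0 ∣ 2) : Occurs K 2 v := by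
  have key := occurs_three_of_data hK hn v hv
  interval_cases n
  · exact key ∅ ∅ (by decide) (by decide) (fun i => i.elim0) (by simp)
  · rcases eq_of_dvd_two (hv 0) with h0 | h0
    · exact key {(1, 2)} {(1, 2)} (by decide) (by decide)
        (Fin.forall_fin_one.2 fun _ => by decide) (by rw [Fin.prod_univ_one, h0]; decide)
    · exact key {(1, 2)} {(1, 2), (1, 0)} (by decide) (by decide)
        (Fin.forall_fin_one.2 fun h => by omega) (by rw [Fin.prod_univ_one, h0]; decide)
  · rcases eq_of_dvd_two (hv 0) with h0 | h0 <;> rcases eq_of_dvd_two (hv 1) with h1 | h1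
    · exact key ∅ {(1, 2)} (by decide) (by decide)
        (Fin.forall_fin_two.2 ⟨fun _ => by decide, fun _ => by decide⟩)
        (by rw [Fin.prod_univ_two, h0, h1]; decide)
    · exact key ∅ {(1, 2), (1, 1)} (by decide) (by decide)
        (Fin.forall_fin_two.2 ⟨fun _ => by decide, fun h => by omega⟩)
        (by rw [Fin.prod_univ_two, h0, h1]; decide)
    · exact key ∅ {(1, 2), (1, 0)} (by decide) (by decide)
        (Fin.forall_fin_two.2 ⟨fun h => by omega, fun _ => by decide⟩)
        (by rw [Fin.prod_univ_two, h0, h1]; decide)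
    · exact key ∅ {(1, 2), (1, 1), (1, 0)} (by decide) (by decide)
        (Fin.forall_fin_two.2 ⟨fun h => by omega, fun h => by omega⟩)
        (by rw [Fin.prod_univ_two, h0, h1]; decide)

end TableData

end PhiSigma

theorem mainTheorem3 (K : Type*) [Field K] [Finite K] :
    (Nat.card K = 3 →
      PhiSigma.HasDecompositions K 2 ∧
      (∀ F G : K[X], F ≠ 0 → G ≠ 0 → PhiSigma.phi K F = PhiSigma.sigma K G →
        ∀ (n : ℕ) (v : Fin n → PhiSigma.ExpTuple) (A B : Fin (n + 1) → K[X]),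
          PhiSigma.IsDecomposition 2 F G v A B → n ≤ 2) ∧
      (∀ n ≤ 2, ∀ v : Fin n → PhiSigma.ExpTuple, (∀ i, (v i).val 0 ∣ 2) →
        PhiSigma.Occurs K 2 v)) ∧
    (Nat.card K = 2 →
      PhiSigma.HasDecompositions K 6 ∧
      (∀ F G : K[X], F ≠ 0 → G ≠ 0 → PhiSigma.phi K F = PhiSigma.sigma K G →
        ∀ (n : ℕ) (v : Fin n → PhiSigma.ExpTuple) (A B : Fin (n + 1) → K[X]),
          PhiSigma.IsDecomposition 6 F G v A B →
            n ≤ 3 ∧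
            (∀ i j, i ≠ j → ¬ ((v i).val 0 = 2 ∧ (v j).val 0 = 2)) ∧
            ¬ (n = 3 ∧ ∀ i, (v i).val 0 = 1)) ∧
      (∀ n ≤ 1, ∀ v : Fin n → PhiSigma.ExpTuple, (∀ i, (v i).val 0 ∣ 6) →
        PhiSigma.Occurs K 6 v) ∧
      (∀ v : Fin 2 → PhiSigma.ExpTuple, (∀ i, (v i).val 0 ∣ 6) → (∀ i, (v i).Reduced 6) →
        ¬ ((v 0).val 0 = 2 ∧ (v 1).val 0 = 2) →
        PhiSigma.Occurs K 6 v) ∧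
      (∀ v : Fin 3 → PhiSigma.ExpTuple, (∀ i, (v i).val 0 ∣ 6) → (∀ i, (v i).Reduced 6) →
        (v 2).val 0 = 1 →
        ¬ ((v 0).val 0 = 2 ∧ (v 1).val 0 = 2) →
        ¬ ((v 0).val 0 = 1 ∧ (v 1).val 0 = 1) →
        PhiSigma.Occurs K 6 v)) := by
  refine ⟨fun hK => ⟨?_, ?_, ?_⟩, fun hK => ⟨?_, ?_, ?_, ?_, ?_⟩⟩
  · exact PhiSigma.hasDecompositions (by norm_num) (hK ▸ PhiSigma.isZsigmondyBound_three)
  · intro F G hF hG hFG n v A B h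
    exact PhiSigma.card_le_two_of_isDecomposition hK h hF hG hFG
  · intro n hn v hv
    exact PhiSigma.occurs_three hK hn v hv
  · exact PhiSigma.hasDecompositions (by norm_num) (hK ▸ PhiSigma.isZsigmondyBound_two)
  · intro F G hF hG hFG n v A B h
    exact PhiSigma.bounds_of_isDecomposition_of_card_eq_two hK h hF hG hFG
  · intro n hn v hv
    refine PhiSigma.occurs_two_of_le_two hK (by omega) v hv fun i j hij => ?_
    exact absurd (Fin.ext (by omega)) hij
  · intro v hv hred h22
    refine PhiSigma.occurs_two_of_le_two hK le_rfl v hv fun i j hij h => ?_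
    have hi := (hred i).eq_of_uses h.1 (by norm_num)
    have hj := (hred j).eq_of_uses h.2 (by norm_num)
    fin_cases i <;> fin_cases j
    · exact hij rfl
    · exact h22 ⟨hi.symm, hj.symm⟩
    · exact h22 ⟨hj.symm, hi.symm⟩
    · exact hij rfl
  · intro v hv hred hv2 h22 h11
    exact PhiSigma.occurs_two_of_three hK v hv hred hv2 h22 h11
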